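/- **The monotile.** Identify the plane with $\mathbb{C}$ and let $\omega=e^{i\pi/3}$. Let $H$ be the closed regular hexagon centred at $0$ with edges $e_0,\dots,e_5$, where $e_k$ has outward unit normal $\omega^k$ and midpoint $\omega^k/2$. For each $k$ let $m_k=\omega^k\left(\tfrac12+\tfrac{i}{8}s_k\right)\in e_k$, where $(s_0,\dots,s_5)=(-1,-1,1,-1,1,1)$. The monotile is $H$ decorated with (i) three black R1-curves: the straight segment from $m_1$ to $m_4$, and two small corner curves (drawn as segments), one from $m_2$ to $m_3$ and one from $m_5$ to $m_0$; and (ii) a red R2-tree, the union of the four segments from $0$ to the midpoints of $e_0,e_1,e_3,e_4$. A tile is a copy of the decorated hexagon under a direct isometry $z\mapsto uz+c$ ($|u|=1$); reflections are not allowed. A tiling is a set of tiles that covers the plane and in which distinct tiles meet only in their boundaries. **Rules.** A tiling satisfies **R1** if the black curves are continuous across tiles: a point common to two tiles lies on the black curves of one if and only if it lies on the black curves of the other. It satisfies **R2** if the union of the R2-trees of all its tiles is connected. In a tiling satisfying R1 every corner curve belongs to an R1-triangle; if this is finite, then it is equilateral with a corner curve at each of its three corners, and its length is the number $n\ge 0$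 of tiles carrying the straight part of any one of its sides. An infinite R1-triangle (two infinite R1-rays joined by a corner curve) has length $\infty$. **The class $\mathcal{C}_0$.** Let $\mathcal{C}_0$ be the collection of all tilings $T$ by the monotile that satisfy R1 and R2 and have the property that any two R1-triangles whose corners meet at a common tile of $T$ have the same length. **Proposition.** The collection $\mathcal{C}_0$ is non-empty, and every tiling in $\mathcal{C}_0$ is nonperiodic, that is, no nonzero translation maps it to itself. -/

import Mathlib

namespace Monotile

open Set

noncomputable section

/-- The sixth root of unity `exp (π i / 3)`; the plane is `ℂ`. -/
def ω : ℂ := ⟨1 / 2, Real.sqrt 3 / 2⟩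

/-- The closed regular hexagon centred at the origin whose opposite edges are at distance `1`.
Edge number `k` (for `k = 0, …, 5`) is the one with outward unit normal `ω ^ k`, and its midpoint
is `ω ^ k / 2`. -/
def hexagon : Set ℂ := {z | ∀ k : Fin 6, (z * (starRingEnd ℂ) (ω ^ (k : ℕ))).re ≤ 1 / 2}

/-- On which side of its midpoint the black decoration meets edge `k`:
`1` is counterclockwise, `-1` is clockwise (seen from the centre of the tile). -/
def offset : Fin 6 → ℝ := ![-1, -1, 1, -1, 1, 1]

/-- The off-centre point at which the black decoration meets edge `k`. -/
def mark (k : Fin 6) : ℂ := ω ^ (k : ℕ) * (1 / 2 + (offset k / 8 : ℝ) * Complex.I)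

/-- The three black R1-curves of the prototile: a straight line joining the opposite edges
`1` and `4`, and two small curves cutting the corner between the edges `2`, `3` and the corner
between the edges `5`, `0`. -/
def protoBlack : Set ℂ :=
  segment ℝ (mark 1) (mark 4) ∪ segment ℝ (mark 2) (mark 3) ∪ segment ℝ (mark 5) (mark 0)

/-- The red R2-tree of the prototile, which meets the edges `0`, `1`, `3`, `4` at their
midpoints. -/
def protoTree : Set ℂ :=
  segment ℝ 0 (ω ^ 0 / 2) ∪ segment ℝ 0 (ω ^ 1 / 2) ∪
    segment ℝ 0 (ω ^ 3 / 2) ∪ segment ℝ 0 (ω ^ 4 / 2)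

/-- A copy of the decorated prototile under the direct isometry `z ↦ rot * z + centre`. -/
@[ext]
structure Tile where
  centre : ℂ
  rot : Circle

namespace Tile

def isometry (t : Tile) (z : ℂ) : ℂ := (t.rot : ℂ) * z + t.centre

/-- The closed hexagon occupied by the tile. -/
def hex (t : Tile) : Set ℂ := t.isometry '' hexagon

/-- The R1-curves of the tile. -/
def black (t : Tile) : Set ℂ := t.isometry '' protoBlack

/-- The R2-tree of the tile. -/
def tree (t : Tile) : Set ℂ := t.isometry '' protoTree

def translate (v : ℂ) (t : Tile) : Tile := ⟨t.centre + v, t.rot⟩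

/-- The straight R1-curve of the tile runs in the direction `d` (equivalently `-d`). -/
def HasLine (t : Tile) (d : ℂ) : Prop := d = t.rot * ω ^ 1 ∨ d = t.rot * ω ^ 4

/-- The tile has a small R1-curve, joining the edge with normal `d` and the next edge
counterclockwise, whose normal is `ω * d`. -/
def HasCorner (t : Tile) (d : ℂ) : Prop := d = t.rot * ω ^ 2 ∨ d = t.rot * ω ^ 5

end Tile

/-- A tiling of the plane by direct isometric copies of the monotile: the tiles cover the plane and
distinct tiles meet only in their boundaries. -/
def IsTiling (T : Set Tile) : Prop :=
  (⋃ t ∈ T, t.hex) = univ ∧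
    ∀ t ∈ T, ∀ t' ∈ T, t ≠ t' → t.hex ∩ t'.hex ⊆ frontier t.hex ∩ frontier t'.hex

/-- Rule **R1**: the black curves are continuous across tiles, i.e. wherever two tiles touch, a
point of the common boundary lies on the black curves of one iff it lies on those of the other. -/
def SatisfiesR1 (T : Set Tile) : Prop :=
  ∀ t ∈ T, ∀ t' ∈ T, t ≠ t' → t.black ∩ t'.hex = t'.black ∩ t.hex

/-- Rule **R2** for a tiling: the union of the R2-trees is connected. -/
def SatisfiesR2 (T : Set Tile) : Prop := IsConnected (⋃ t ∈ T, t.tree)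

/-- The tile centred at `p` has a small R1-curve opening in the directions `d` and `ω * d`. -/
def CornerAt (T : Set Tile) (p d : ℂ) : Prop := ∃ t ∈ T, t.centre = p ∧ t.HasCorner d

/-- The `n` tiles following the one centred at `p` in the direction `d` all carry a straight
R1-curve running in that direction. -/
def LineFrom (T : Set Tile) (p d : ℂ) (n : ℕ) : Prop :=
  ∀ j : ℕ, 1 ≤ j → j ≤ n → ∃ t ∈ T, t.centre = p + j * d ∧ t.HasLine d

/-- The small R1-curve at `p` that opens in the directions `d` and `ω * d` belongs to a finite
R1-triangle of length `n`: its corner tiles are centred at `p`, `p + (n + 1) d` and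
`p + (n + 1) ω d`, and each of its three sides is a straight R1-line segment comprising the `n`
tiles between two corner tiles. -/
def IsR1Triangle (T : Set Tile) (p d : ℂ) (n : ℕ) : Prop :=
  (CornerAt T p d ∧ LineFrom T p d n) ∧
  (CornerAt T (p + (n + 1) * d) (ω ^ 2 * d) ∧
    LineFrom T (p + (n + 1) * d) (ω ^ 2 * d) n) ∧
  (CornerAt T (p + (n + 1) * (ω * d)) (ω ^ 4 * d) ∧
    LineFrom T (p + (n + 1) * (ω * d)) (ω ^ 4 * d) n)

/-- The length of the R1-triangle through the small R1-curve at `p` that opens in the directions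
`d` and `ω * d`; it is `⊤` if that R1-triangle is infinite. -/
def r1Length (T : Set Tile) (p d : ℂ) : ℕ∞ :=
  ⨅ (n : ℕ) (_ : IsR1Triangle T p d n), (n : ℕ∞)

/-- The class `𝒞` of all tilings by the monotile that satisfy **R1** and **R2**. -/
def classC : Set (Set Tile) := {T | IsTiling T ∧ SatisfiesR1 T ∧ SatisfiesR2 T}

/-- The class `𝒞₀`: two R1-triangles whose corners meet at a common tile have the same length. -/
def classC0 : Set (Set Tile) :=
  {T | T ∈ classC ∧ ∀ t ∈ T, ∀ d d' : ℂ, t.HasCorner d → t.HasCorner d' →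
    r1Length T t.centre d = r1Length T t.centre d'}

/-- A tiling is nonperiodic if no nonzero translation maps it to itself. -/
def Nonperiodic (T : Set Tile) : Prop := ∀ v : ℂ, Tile.translate v '' T = T → v = 0

end

end Monotile

/-!
Every tiling by the monotile is a honeycomb: the centres of two tiles have distance at least `1`,
three tiles are needed around a vertex, and three points with mutual distances at least `1` in a
disc of radius `1 / √3` form an equilateral triangle (`IsTiling.exists_eq_latticeTiling`). A tiling
is therefore a field of orientations on the triangular lattice `ℤ[ω]`. Rule **R1** becomes the
combinatorial condition `IsMatched`: along each row of the lattice, the tiles whose straight curve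
does not run along the row turn the black curve alternately to the right and to the left. The
condition on lengths that singles out `𝒞₀` becomes `IsBalanced`: opposite corners of a tile belong
to triangles of the same size (`satisfiesR1_iff`, `lengths_eq_iff`).

*Nonperiodicity.* Rule **R1** forces three mutually adjacent tiles to form a triangle somewhere
(`IsMatched.exists_triangle`). In a balanced field such smallest triangles propagate
(`IsBalanced.isSmall_step`) and occupy all of the lattice except a coset of `2 ℤ[ω]`, whose points,
the holes, are surrounded by straight curves pointing at them. These curves transmit the black
curves between holes, so the field restricted to the coset is again matched and balanced
(`IsMatched.rescale`, `IsBalanced.rescale`). A period of the field lies in `2 ℤ[ω]` and descends to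
the restricted field; hence it is divisible by all powers of `2` and vanishes.

*Existence.* Iterating this description, the field is determined by the limit `c` of the cosets of
holes in the `2`-adic completion: the axis of the tile at `z` is the class modulo `2` of the odd
part of `z - c`. The choice `c = (-1 + 2 ω ^ 2) / 7` works. Its R1-triangles all have sides
`2 ^ k`, which gives the balance condition (`isTriangle_field_iff`). The red trees are connected
because each tile is linked to a tile in the image of the similarity of factor `8` about `c`; this
similarity preserves links, and so links are traced back to a finite patch (`redConnected_zero`).
-/

namespace Monotile

open Set Filter Topology

noncomputable section

/-! ### Axis fields on the triangular lattice -/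

/-- The six shortest vectors of the triangular lattice, in counterclockwise order, in coordinates
with respect to the basis `1, ω ^ 2`; the vector number `j` stands for `ω ^ j`. -/
def step : ZMod 6 → ℤ × ℤ := ![(1, 0), (1, 1), (0, 1), (-1, 0), (-1, -1), (0, -1)]

/-- The class of a direction up to sign, numbered so that `axis (2 * b) = b`. -/
def axis : ZMod 6 → ZMod 3 := ![0, 2, 1, 0, 2, 1]

theorem step_add_three (j : ZMod 6) : step (j + 3) = -step j := by decide +revert
theorem step_add_two (j : ZMod 6) : step (j + 2) = step (j + 1) - step j := by decide +revert
theorem step_add_four (j : ZMod 6) : step (j + 4) = -step (j + 1) := by decide +revert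
theorem step_add_five (j : ZMod 6) : step (j + 5) = step j - step (j + 1) := by decide +revert

theorem axis_add_one (j : ZMod 6) : axis (j + 1) = axis j - 1 := by decide +revert
theorem axis_add_two (j : ZMod 6) : axis (j + 2) = axis j + 1 := by decide +revert
theorem axis_add_three (j : ZMod 6) : axis (j + 3) = axis j := by decide +revert
theorem axis_add_four (j : ZMod 6) : axis (j + 4) = axis j - 1 := by decide +revert
theorem axis_add_five (j : ZMod 6) : axis (j + 5) = axis j + 1 := by decide +revert

theorem eq_or_eq_add_three_of_axis_eq {i j : ZMod 6} (h : axis i = axis j) :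
    i = j ∨ i = j + 3 := by decide +revert

/-- A property of lattice points that passes to neighbours holds everywhere. -/
theorem lattice_induction {P : ℤ × ℤ → Prop} (h0 : P 0) (hs : ∀ x j, P x → P (x + step j))
    (x : ℤ × ℤ) : P x := by
  have row : ∀ (v : ℤ × ℤ), (∃ j, step j = v) → (∃ j, step j = -v) → ∀ (n : ℤ) (y : ℤ × ℤ),
      P y → P (y + n • v) := by
    rintro v ⟨i, hi⟩ ⟨j, hj⟩ n y hy
    induction n using Int.induction_on with
    | zero => simpa using hy
    | succ n ih =>
      have := hs _ i ih
      rwa [hi, add_assoc, ← add_one_zsmul] at this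
    | pred n ih =>
      have := hs _ j ih
      rwa [hj, add_assoc, ← sub_one_zsmul] at this
  have := row (0, 1) ⟨2, rfl⟩ ⟨5, rfl⟩ x.2 _ (row (1, 0) ⟨0, rfl⟩ ⟨3, rfl⟩ x.1 0 h0)
  simpa using this

theorem exists_axis_eq (c : ZMod 3) : ∃ j, axis j = c := by decide +revert

/-- The combinatorial form of rule **R1**: `h x` is the axis of the straight curve of the tile at
the lattice point `x`, and `s x j` says that the black curves of that tile leave through edge `j`
to the right of its midpoint, seen from `x`. -/
structure IsMatched (h : ℤ × ℤ → ZMod 3) (s : ℤ × ℤ → ZMod 6 → Prop) : Prop where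
  line : ∀ x j, h x = axis j → (s x (j + 3) ↔ ¬ s x j)
  right : ∀ x j, h x = axis j - 1 → s x j
  left : ∀ x j, h x = axis j + 1 → ¬ s x j
  glue : ∀ x j, s (x + step j) (j + 3) ↔ ¬ s x j

/-- The small curve at `p` that opens in the directions `j` and `j + 1` belongs to an R1-triangle
whose sides have length `N`, measured between the centres of its corner tiles. -/
def IsTriangle (h : ℤ × ℤ → ZMod 3) (p : ℤ × ℤ) (j : ZMod 6) (N : ℤ) : Prop :=
  (h p = axis j + 1 ∧ ∀ i, 0 < i → i < N → h (p + i • step j) = axis j) ∧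
  (h (p + N • step j) = axis (j + 2) + 1 ∧
    ∀ i, 0 < i → i < N → h (p + N • step j + i • step (j + 2)) = axis (j + 2)) ∧
  (h (p + N • step (j + 1)) = axis (j + 4) + 1 ∧
    ∀ i, 0 < i → i < N → h (p + N • step (j + 1) + i • step (j + 4)) = axis (j + 4))

/-- Opposite corners of a tile belong to R1-triangles of the same size. -/
def IsBalanced (h : ℤ × ℤ → ZMod 3) : Prop :=
  ∀ p j N, 0 < N → IsTriangle h p j N → IsTriangle h p (j + 3) N

section Field

variable {h : ℤ × ℤ → ZMod 3} {s : ℤ × ℤ → ZMod 6 → Prop}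

/-- Adjacent tiles with the same axis lie on a common straight curve. -/
theorem IsMatched.eq_axis (H : IsMatched h s) {x : ℤ × ℤ} {j : ZMod 6}
    (e : h x = h (x + step j)) : h x = axis j := by
  have key : ∀ a b : ZMod 3, a = b ∨ a = b - 1 ∨ a = b + 1 := by decide
  rcases key (h x) (axis j) with h1 | h1 | h1
  · exact h1
  · have h2 := H.right x j h1
    have h3 := H.right (x + step j) (j + 3) (by rw [axis_add_three, ← e, h1])
    exact absurd h2 ((H.glue x j).1 h3)
  · have h2 := H.left x j h1
    have h3 := H.left (x + step j) (j + 3) (by rw [axis_add_three, ← e, h1])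
    exact absurd ((H.glue x j).2 h2) h3

theorem isTriangle_one_iff {p : ℤ × ℤ} {j : ZMod 6} : IsTriangle h p j 1 ↔
    h p = axis j + 1 ∧ h (p + step j) = axis j - 1 ∧ h (p + step (j + 1)) = axis j := by
  have e1 : axis j + 1 + 1 = axis j - 1 := by generalize axis j = a; decide +revert
  have e2 : axis j - 1 + 1 = axis j := by ring
  have no : ∀ i : ℤ, 0 < i → i < 1 → False := by intros; omega
  simp only [IsTriangle, axis_add_two, axis_add_four, one_smul, e1, e2]
  exact ⟨fun H => ⟨H.1.1, H.2.1.1, H.2.2.1⟩, fun H =>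
    ⟨⟨H.1, fun i a b => (no i a b).elim⟩, ⟨H.2.1, fun i a b => (no i a b).elim⟩,
      ⟨H.2.2, fun i a b => (no i a b).elim⟩⟩⟩

set_option synthInstance.maxSize 1000 in
/-- Three mutually adjacent tiles form an R1-triangle somewhere near each lattice point: the two
neighbours `y`, `r` of `x` in the opening of one of its corners have distinct axes, and either `x`
or the reflection `q` of `x` in `y r` completes the triangle. -/
theorem IsMatched.exists_triangle (H : IsMatched h s) : ∃ p j, IsTriangle h p j 1 := by
  obtain ⟨j, hj⟩ := exists_axis_eq (h 0 - 1)
  have a1 := H.eq_axis (x := 0) (j := j)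
  have a2 := H.eq_axis (x := 0) (j := j + 1)
  have a3 := H.eq_axis (x := 0 + step j) (j := j + 2)
  have a4 := H.eq_axis (x := 0 + step j) (j := j + 1)
  have a5 := H.eq_axis (x := 0 + step (j + 1)) (j := j)
  have e3 : (0 : ℤ × ℤ) + step j + step (j + 2) = 0 + step (j + 1) := by rw [step_add_two]; abel
  have e5 : (0 : ℤ × ℤ) + step (j + 1) + step j = 0 + step j + step (j + 1) := by abel
  rw [e3] at a3
  rw [e5] at a5
  have t1 := isTriangle_one_iff (h := h) (p := 0) (j := j)
  have t2 := isTriangle_one_iff (h := h) (p := 0 + step j) (j := j + 1)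
  rw [show j + 1 + 1 = j + 2 by ring, e3] at t2
  rw [axis_add_one] at a2 a4 t2
  rw [axis_add_two] at a3
  by_contra hno
  push Not at hno
  have n1 := mt t1.2 (hno _ _)
  have n2 := mt t2.2 (hno _ _)
  clear hno t1 t2
  generalize h 0 = x0 at *
  generalize h (0 + step j + step (j + 1)) = q at *
  generalize h (0 + step j) = y at *
  generalize h (0 + step (j + 1)) = r at *
  generalize axis j = a at *
  clear e3 e5 H
  revert x0 q y r a
  decide

/-- The lattice point `p` is a corner of an R1-triangle formed by three adjacent tiles. -/
def IsSmall (h : ℤ × ℤ → ZMod 3) (p : ℤ × ℤ) : Prop := ∃ j, IsTriangle h p j 1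

/-- In a balanced field every corner of a small triangle carries two of them, and the neighbours
in the four corner directions are corners of small triangles as well. -/
theorem IsBalanced.isSmall_step (B : IsBalanced h) {p : ℤ × ℤ} (hp : IsSmall h p) {j : ZMod 6}
    (hj : h p = axis j + 1) :
    (IsSmall h (p + step j) ∧ h (p + step j) = axis j - 1) ∧
      (IsSmall h (p + step (j + 1)) ∧ h (p + step (j + 1)) = axis j) := by
  have tri : IsTriangle h p j 1 := by
    obtain ⟨i, hi⟩ := hp
    have e : axis i = axis j := add_right_cancel (hi.1.1.symm.trans hj)
    rcases eq_or_eq_add_three_of_axis_eq e with rfl | rfl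
    · exact hi
    · have := B p _ 1 one_pos hi
      rwa [show j + 3 + 3 = j by rw [add_assoc, show (3 : ZMod 6) + 3 = 0 by decide, add_zero]]
        at this
  have t := isTriangle_one_iff.1 tri
  refine ⟨⟨⟨j + 2, isTriangle_one_iff.2 ?_⟩, t.2.1⟩, ⟨⟨j + 4, isTriangle_one_iff.2 ?_⟩, t.2.2⟩⟩
  · rw [show j + 2 + 1 = j + 3 by ring, step_add_two, step_add_three, axis_add_two,
      show p + step j + (step (j + 1) - step j) = p + step (j + 1) by abel,
      show p + step j + -step j = p by abel, t.1, t.2.1, t.2.2]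
    generalize axis j = a
    decide +revert
  · rw [show j + 4 + 1 = j + 5 by ring, step_add_four, step_add_five, axis_add_four,
      show p + step (j + 1) + (step j - step (j + 1)) = p + step j by abel,
      show p + step (j + 1) + -step (j + 1) = p by abel, t.1, t.2.1, t.2.2]
    generalize axis j = a
    decide +revert

/-- The six neighbours of `y` all lie on small triangles, with straight curves pointing at `y`. -/
def IsHole (h : ℤ × ℤ → ZMod 3) (y : ℤ × ℤ) : Prop :=
  ∀ j, IsSmall h (y + step j) ∧ h (y + step j) = axis j

theorem IsBalanced.isHole (B : IsBalanced h) {p : ℤ × ℤ} (hp : IsSmall h p) {j : ZMod 6}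
    (hj : h p = axis j) : IsHole h (p + step j) := by
  have i0 : p + step j + step (j + 3) = p := by rw [step_add_three]; abel
  have u1 := (B.isSmall_step hp (j := j + 1) (by rw [axis_add_one, hj]; ring)).1
  have u2 := (B.isSmall_step hp (j := j + 4) (by rw [axis_add_four, hj]; ring)).2
  rw [show j + 4 + 1 = j + 5 by ring] at u2
  have i2 : p + step (j + 1) = p + step j + step (j + 2) := by rw [step_add_two]; abel
  have i4 : p + step (j + 5) = p + step j + step (j + 4) := by
    rw [step_add_four, step_add_five]; abel
  rw [i2, axis_add_one] at u1
  rw [i4, axis_add_four] at u2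
  have u3 := (B.isSmall_step u1.1 (j := j) (by
    rw [u1.2]; generalize axis j = a; decide +revert)).1
  have i1 : p + step j + step (j + 2) + step j = p + step j + step (j + 1) := by
    rw [step_add_two]; abel
  rw [i1] at u3
  have u4 := (B.isSmall_step u2.1 (j := j + 5) (by
    rw [u2.2, axis_add_five]; generalize axis j = a; decide +revert)).2
  have i5 : p + step j + step (j + 4) + step (j + 5 + 1) = p + step j + step (j + 5) := by
    rw [show j + 5 + 1 = j by rw [add_assoc, show (5 : ZMod 6) + 1 = 0 by decide, add_zero],
      step_add_four, step_add_five]; abel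
  rw [i5] at u4
  have u5 := (B.isSmall_step u3.1 (j := j + 5) (by
    rw [u3.2, axis_add_five]; generalize axis j = a; decide +revert)).1
  have i6 : p + step j + step (j + 1) + step (j + 5) = p + step j + step j := by
    rw [step_add_five]; abel
  rw [i6] at u5
  intro i
  obtain ⟨k, rfl⟩ : ∃ k, i = j + k := ⟨i - j, by ring⟩
  have hk : k = 0 ∨ k = 1 ∨ k = 2 ∨ k = 3 ∨ k = 4 ∨ k = 5 := by decide +revert
  rcases hk with rfl | rfl | rfl | rfl | rfl | rfl
  · rw [add_zero]
    exact ⟨u5.1, by rw [u5.2, axis_add_five]; ring⟩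
  · exact ⟨u3.1, by rw [u3.2, axis_add_one]⟩
  · exact ⟨u1.1, by rw [u1.2, axis_add_two]; generalize axis j = a; decide +revert⟩
  · rw [i0]; exact ⟨hp, by rw [hj, axis_add_three]⟩
  · exact ⟨u2.1, by rw [u2.2, axis_add_four]⟩
  · exact ⟨u4.1, by rw [u4.2]⟩

theorem IsBalanced.isHole_add (B : IsBalanced h) {y : ℤ × ℤ} (hy : IsHole h y) (j : ZMod 6) :
    IsHole h (y + (2 : ℤ) • step j) := by
  have := B.isHole (hy j).1 (hy j).2
  rwa [add_assoc, ← two_zsmul] at this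

/-- The holes of a balanced field contain a coset of the doubled lattice. -/
theorem IsBalanced.isHole_add_two_smul (B : IsBalanced h) {y : ℤ × ℤ} (hy : IsHole h y)
    (z : ℤ × ℤ) : IsHole h (y + (2 : ℤ) • z) := by
  refine lattice_induction (P := fun z => IsHole h (y + (2 : ℤ) • z)) (by simpa using hy) ?_ z
  intro x j hx
  rw [smul_add, ← add_assoc]
  exact B.isHole_add hx j

/-- The field seen on the coset `y + 2 L` of the doubled lattice. -/
def rescale {α : Type*} (y : ℤ × ℤ) (f : ℤ × ℤ → α) (z : ℤ × ℤ) : α := f (y + (2 : ℤ) • z)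

theorem IsMatched.rescale (H : IsMatched h s) {y : ℤ × ℤ} (hy : ∀ z, IsHole h (y + (2 : ℤ) • z)) :
    IsMatched (rescale y h) (rescale y s) where
  line x j := H.line _ j
  right x j := H.right _ j
  left x j := H.left _ j
  glue x j := by
    have l := H.line _ _ ((hy x) j).2
    have g := H.glue (y + (2 : ℤ) • x) j
    have g' := H.glue (y + (2 : ℤ) • x + step j) j
    have e : y + (2 : ℤ) • (x + step j) = y + (2 : ℤ) • x + step j + step j := by module
    unfold Monotile.rescale
    rw [e, g', ← l, g]

theorem isTriangle_rescale {y : ℤ × ℤ} (hy : ∀ z, IsHole h (y + (2 : ℤ) • z)) {p : ℤ × ℤ}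
    {j : ZMod 6} {N : ℤ} :
    IsTriangle (rescale y h) p j N ↔ IsTriangle h (y + (2 : ℤ) • p) j (2 * N) := by
  have side : ∀ (q : ℤ × ℤ) (i : ZMod 6),
      (∀ t, 0 < t → t < N → rescale y h (q + t • step i) = axis i) ↔
        ∀ t, 0 < t → t < 2 * N → h (y + (2 : ℤ) • q + t • step i) = axis i := by
    intro q i
    have e : ∀ t : ℤ, y + (2 : ℤ) • (q + t • step i) = y + (2 : ℤ) • q + (2 * t) • step i := by
      intro t; module
    constructor
    · intro H t h0 h1
      rcases Int.even_or_odd' t with ⟨k, rfl | rfl⟩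
      · rw [← e]; exact H k (by omega) (by omega)
      · rw [show y + (2 : ℤ) • q + (2 * k + 1) • step i = y + (2 : ℤ) • (q + k • step i) + step i
          by module]
        exact (hy _ i).2
    · intro H t h0 h1
      unfold Monotile.rescale
      rw [e]
      exact H _ (by omega) (by omega)
  have e : ∀ i : ZMod 6, y + (2 : ℤ) • (p + N • step i) = y + (2 : ℤ) • p + (2 * N) • step i := by
    intro i; module
  unfold IsTriangle
  rw [side, side, side]
  unfold rescale
  rw [e, e]

theorem IsBalanced.rescale (B : IsBalanced h) {y : ℤ × ℤ}
    (hy : ∀ z, IsHole h (y + (2 : ℤ) • z)) : IsBalanced (rescale y h) := by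
  intro p j N hN ht
  rw [isTriangle_rescale hy] at ht ⊢
  exact B _ _ _ (by omega) ht

/-- A period of a balanced field belongs to the doubled lattice, since around a hole the axis
determines the coset of the doubled lattice. -/
theorem exists_eq_two_smul_of_period {y v : ℤ × ℤ} (hy : ∀ z, IsHole h (y + (2 : ℤ) • z))
    (hv : ∀ z, h (z + v) = h z) : ∃ w, v = (2 : ℤ) • w := by
  have cls : ∀ a b : ℤ × ℤ, ∀ j : ZMod 6, a = (2 : ℤ) • b + step j → h (y + a) = axis j := by
    rintro a b j rfl
    rw [← add_assoc]
    exact (hy b j).2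
  have hv' : ∀ a, h (y + a + v) = h (y + a) := fun a => hv _
  rcases v with ⟨m, n⟩
  rcases Int.even_or_odd' m with ⟨m', rfl | rfl⟩ <;> rcases Int.even_or_odd' n with ⟨n', rfl | rfl⟩
  · exact ⟨(m', n'), by simp⟩
  · have h1 := cls (1, 0) 0 0 (by simp [step])
    have h2 := cls ((1, 0) + (2 * m', 2 * n' + 1)) (m', n') 1 (by
      ext <;> simp [step]
      ring)
    rw [← add_assoc, hv', h1] at h2
    exact absurd h2 (by decide)
  · have h1 := cls (0, 1) 0 2 (by simp [step])
    have h2 := cls ((0, 1) + (2 * m' + 1, 2 * n')) (m', n') 1 (by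
      ext <;> simp [step]
      ring)
    rw [← add_assoc, hv', h1] at h2
    exact absurd h2 (by decide)
  · have h1 := cls (1, 0) 0 0 (by simp [step])
    have h2 := cls ((1, 0) + (2 * m' + 1, 2 * n' + 1)) (m' + 1, n') 2
      (by
      ext <;> simp [step]
      ring)
    rw [← add_assoc, hv', h1] at h2
    exact absurd h2 (by decide)

/-- A period of a balanced field is divisible by every power of two: the holes carry a balanced
field of half the scale, which inherits half of the period. -/
theorem exists_eq_two_pow_smul_of_period (k : ℕ) (h : ℤ × ℤ → ZMod 3) (s : ℤ × ℤ → ZMod 6 → Prop)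
    (v : ℤ × ℤ) (H : IsMatched h s) (B : IsBalanced h) (hv : ∀ z, h (z + v) = h z) :
    ∃ w, v = (2 ^ k : ℤ) • w := by
  induction k generalizing h s v with
  | zero => exact ⟨v, by simp⟩
  | succ k ih =>
    obtain ⟨p, j, hp⟩ := H.exists_triangle
    obtain ⟨i, hi⟩ := exists_axis_eq (h p)
    have hy := B.isHole_add_two_smul (B.isHole ⟨j, hp⟩ hi.symm)
    obtain ⟨w, rfl⟩ := exists_eq_two_smul_of_period hy hv
    obtain ⟨u, rfl⟩ := ih _ _ w (H.rescale hy) (B.rescale hy) (fun z => by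
      simp only [rescale, smul_add, ← add_assoc, hv])
    exact ⟨u, by rw [smul_smul]; congr 1; ring⟩

theorem eq_zero_of_period (H : IsMatched h s) (B : IsBalanced h) {v : ℤ × ℤ}
    (hv : ∀ z, h (z + v) = h z) : v = 0 := by
  have small : ∀ m : ℤ, (∀ k : ℕ, (2 ^ k : ℤ) ∣ m) → m = 0 := by
    intro m hm
    by_contra hne
    have := Int.natAbs_dvd_natAbs.2 (hm m.natAbs)
    have h2 := Nat.le_of_dvd (Int.natAbs_pos.2 hne) this
    rw [Int.natAbs_pow] at h2
    exact absurd h2 (not_le.2 (by simpa using Nat.lt_two_pow_self))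
  have key := fun k => exists_eq_two_pow_smul_of_period k h s v H B hv
  ext
  · exact small _ fun k => by
      obtain ⟨w, hw⟩ := key k
      exact ⟨w.1, by rw [hw]; simp⟩
  · exact small _ fun k => by
      obtain ⟨w, hw⟩ := key k
      exact ⟨w.2, by rw [hw]; simp⟩

end Field

/-! ### A hierarchical axis field -/

/-- `w` is `2 ^ k` times a lattice vector congruent modulo `2` to a shortest vector of axis `c`.
Every nonzero `w` has exactly one level `k` and one class `c`. -/
def HasLevel (w : ℤ × ℤ) (k : ℕ) (c : ZMod 3) : Prop :=
  ∃ j v, axis j = c ∧ w = (2 ^ k : ℤ) • (step j + (2 : ℤ) • v)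

theorem HasLevel.unique {w : ℤ × ℤ} {k k' : ℕ} {c c' : ZMod 3} (h : HasLevel w k c)
    (h' : HasLevel w k' c') : k = k' ∧ c = c' := by
  have main : ∀ {k k' : ℕ} {c c' : ZMod 3}, k ≤ k' → HasLevel w k c → HasLevel w k' c' →
      k = k' ∧ c = c' := by
    rintro k k' c c' hk ⟨j, v, rfl, hw⟩ ⟨j', v', rfl, hw'⟩
    obtain ⟨d, rfl⟩ := Nat.exists_eq_add_of_le hk
    have e : step j + (2 : ℤ) • v = (2 ^ d : ℤ) • (step j' + (2 : ℤ) • v') := by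
      have : (2 ^ k : ℤ) • (step j + (2 : ℤ) • v)
          = (2 ^ k : ℤ) • (2 ^ d : ℤ) • (step j' + (2 : ℤ) • v') := by
        rw [← hw, hw', smul_smul, pow_add]
      exact smul_right_injective _ (by positivity) this
    have e1 := congrArg Prod.fst e
    have e2 := congrArg Prod.snd e
    simp only [Prod.fst_add, Prod.snd_add, Prod.smul_fst, Prod.smul_snd, smul_eq_mul] at e1 e2
    rcases d with _ | d
    · refine ⟨rfl, ?_⟩
      have key : ∀ j j' : ZMod 6, (step j).1 % 2 = (step j').1 % 2 →
          (step j).2 % 2 = (step j').2 % 2 → axis j = axis j' := by decide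
      exact key j j' (by omega) (by omega)
    · exfalso
      have key : ∀ j : ZMod 6, ¬ ((step j).1 % 2 = 0 ∧ (step j).2 % 2 = 0) := by decide
      rw [pow_succ', mul_assoc] at e1 e2
      exact key j ⟨by omega, by omega⟩
  rcases le_total k k' with hk | hk
  · exact main hk h h'
  · obtain ⟨a, b⟩ := main hk h' h
    exact ⟨a.symm, b.symm⟩

theorem HasLevel.two_pow_smul {w : ℤ × ℤ} {k : ℕ} {c : ZMod 3} (h : HasLevel w k c) (i : ℕ) :
    HasLevel ((2 ^ i : ℤ) • w) (k + i) c := by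
  obtain ⟨j, v, hc, rfl⟩ := h
  exact ⟨j, v, hc, by rw [smul_smul, pow_add, mul_comm]⟩

theorem exists_hasLevel {w : ℤ × ℤ} (hw : w ≠ 0) : ∃ k c, HasLevel w k c := by
  induction hn : w.1.natAbs + w.2.natAbs using Nat.strong_induction_on generalizing w with
  | _ n ih =>
    rcases w with ⟨a, b⟩
    simp only at hn
    rcases Int.even_or_odd' a with ⟨a', rfl | rfl⟩ <;>
      rcases Int.even_or_odd' b with ⟨b', rfl | rfl⟩
    · have hne : (a', b') ≠ (0 : ℤ × ℤ) := by
        intro h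
        simp only [Prod.mk_eq_zero] at h
        exact hw (by simp [h.1, h.2])
      have : a' ≠ 0 ∨ b' ≠ 0 := by
        by_contra! h
        exact hne (by simp [h.1, h.2])
      obtain ⟨k, c, h⟩ := ih (a'.natAbs + b'.natAbs) (by omega) hne rfl
      exact ⟨k + 1, c, by simpa using h.two_pow_smul 1⟩
    · exact ⟨0, _, 2, (a', b'), rfl, by ext <;> simp [step]; ring⟩
    · exact ⟨0, _, 0, (a', b'), rfl, by ext <;> simp [step]; ring⟩
    · exact ⟨0, _, 1, (a', b'), rfl, by ext <;> simp [step] <;> ring⟩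

/-- Adding a multiple of lower level produces the level of the multiple and its class. -/
theorem HasLevel.add_of_lt {w : ℤ × ℤ} {k : ℕ} {c : ZMod 3} (h : HasLevel w k c) {i : ℕ}
    (hi : i < k) {n : ℤ} (hn : Odd n) (j : ZMod 6) :
    HasLevel (w + (2 ^ i * n) • step j) i (axis j) := by
  obtain ⟨j', v, -, rfl⟩ := h
  obtain ⟨d, rfl⟩ := Nat.exists_eq_add_of_lt hi
  obtain ⟨m, rfl⟩ := hn
  refine ⟨j, (2 ^ d : ℤ) • (step j' + (2 : ℤ) • v) + m • step j, rfl, ?_⟩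
  rw [pow_succ, pow_add]
  module

/-- Adding a multiple of the same level and of another class produces the third class. -/
theorem HasLevel.add_of_ne {w : ℤ × ℤ} {k : ℕ} {c : ZMod 3} (h : HasLevel w k c) {n : ℤ}
    (hn : Odd n) {j : ZMod 6} (hj : c ≠ axis j) :
    HasLevel (w + (2 ^ k * n) • step j) k (-(c + axis j)) := by
  obtain ⟨i, v, rfl, rfl⟩ := h
  obtain ⟨m, rfl⟩ := hn
  have key : ∀ i j : ZMod 6, axis i ≠ axis j → ∃ l, axis l = -(axis i + axis j) ∧
      (step l = step i + step j ∨ step l = step i - step j) := by decide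
  obtain ⟨l, hl, e | e⟩ := key i j hj
  · exact ⟨l, v + m • step j, hl, by rw [e]; module⟩
  · exact ⟨l, v + (m + 1) • step j, hl, by rw [e]; module⟩

/-- The vector `7 (z - c)`, where `c = (-1, 2) / 7` is the centre of the hierarchy. The
denominator is odd, so that the divisibility of `z - c` by powers of two makes sense, and `c` is
chosen such that the red trees are connected. -/
def fromCentre (z : ℤ × ℤ) : ℤ × ℤ := (7 : ℤ) • z - (-1, 2)

theorem fromCentre_ne_zero (z : ℤ × ℤ) : fromCentre z ≠ 0 := by
  intro h
  have := congrArg Prod.snd h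
  simp [fromCentre] at this
  omega

/-- The level of a tile: its R1-triangles have sides `2 ^ level z`, measured between the centres
of corner tiles. -/
def level (z : ℤ × ℤ) : ℕ := (exists_hasLevel (fromCentre_ne_zero z)).choose

/-- The axis of the straight curve of the tile at `z` in the hierarchical tiling. -/
def field (z : ℤ × ℤ) : ZMod 3 :=
  (exists_hasLevel (fromCentre_ne_zero z)).choose_spec.choose

theorem hasLevel_level (z : ℤ × ℤ) : HasLevel (fromCentre z) (level z) (field z) :=
  (exists_hasLevel (fromCentre_ne_zero z)).choose_spec.choose_spec

theorem HasLevel.eq {z : ℤ × ℤ} {k : ℕ} {c : ZMod 3} (h : HasLevel (fromCentre z) k c) :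
    level z = k ∧ field z = c :=
  (hasLevel_level z).unique h

theorem fromCentre_add_smul (z : ℤ × ℤ) (t : ℤ) (v : ℤ × ℤ) :
    fromCentre (z + t • v) = fromCentre z + (t * 7) • v := by
  unfold fromCentre
  module

theorem field_add_of_lt {z : ℤ × ℤ} {t : ℤ} (h0 : 0 < t) (h1 : t < 2 ^ level z) (j : ZMod 6) :
    field (z + t • step j) = axis j := by
  lift t to ℕ using h0.le
  obtain ⟨i, n, hn, rfl⟩ := Nat.exists_eq_two_pow_mul_odd (n := t) (by omega)
  have hi : i < level z := by
    have h2 : 2 ^ i * n < 2 ^ level z := by exact_mod_cast h1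
    have h3 : 2 ^ i ≤ 2 ^ i * n := Nat.le_mul_of_pos_right _ hn.pos
    exact (Nat.pow_lt_pow_iff_right (by norm_num)).1 (h3.trans_lt h2)
  have := (hasLevel_level z).add_of_lt hi (n := n * 7)
    (Odd.mul (by exact_mod_cast hn) (by decide)) j
  refine (HasLevel.eq (k := i) ?_).2
  rw [fromCentre_add_smul]
  convert this using 3
  push_cast
  ring

theorem level_add {z : ℤ × ℤ} {j : ZMod 6} (hj : field z ≠ axis j) :
    level (z + (2 ^ level z : ℤ) • step j) = level z ∧
      field (z + (2 ^ level z : ℤ) • step j) = -(field z + axis j) := by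
  refine HasLevel.eq ?_
  rw [fromCentre_add_smul]
  exact (hasLevel_level z).add_of_ne (by decide) hj

theorem isTriangle_field_iff {p : ℤ × ℤ} {j : ZMod 6} {N : ℤ} (hN : 0 < N) :
    IsTriangle field p j N ↔ field p = axis j + 1 ∧ N = 2 ^ level p := by
  have n1 : axis j + 1 ≠ axis j := by generalize axis j = a; decide +revert
  have n2 : axis j + 1 ≠ axis j - 1 := by generalize axis j = a; decide +revert
  have n3 : axis j - 1 ≠ axis j := by generalize axis j = a; decide +revert
  constructor
  · rintro ⟨⟨h1, h2⟩, ⟨h3, -⟩, -⟩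
    refine ⟨h1, ?_⟩
    rw [axis_add_two, add_assoc] at h3
    rcases lt_trichotomy N (2 ^ level p) with hlt | heq | hgt
    · rw [field_add_of_lt hN hlt] at h3
      generalize axis j = a at h3
      exact absurd h3 (by decide +revert)
    · exact heq
    · have := h2 _ (by positivity) hgt
      rw [(level_add (h1.trans_ne n1)).2, h1] at this
      generalize axis j = a at this
      exact absurd this (by decide +revert)
  · rintro ⟨h1, rfl⟩
    obtain ⟨q1, q2⟩ := level_add (h1.trans_ne n1)
    obtain ⟨r1, r2⟩ := level_add (j := j + 1) (h1.trans_ne (by rwa [axis_add_one]))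
    refine ⟨⟨h1, fun i h0 hi => field_add_of_lt h0 hi j⟩,
      ⟨?_, fun i h0 hi => field_add_of_lt h0 (by rwa [q1]) _⟩,
      ⟨?_, fun i h0 hi => field_add_of_lt h0 (by rwa [r1]) _⟩⟩
    · rw [q2, h1, axis_add_two]; generalize axis j = a; decide +revert
    · rw [r2, h1, axis_add_one, axis_add_four]; generalize axis j = a; decide +revert

theorem isBalanced_field : IsBalanced field := by
  intro p j N hN h
  rw [isTriangle_field_iff hN] at h ⊢
  rwa [axis_add_three]

/-! ### Orientations of tiles -/

/-- The axis of the straight curve of a tile rotated by `ω ^ k`. -/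
def tileAxis : ZMod 6 → ZMod 3 := ![2, 1, 0, 2, 1, 0]

/-- The black curves of the prototile meet edge `l` to the right of its midpoint, seen from the
centre. -/
def onRight : ZMod 6 → Bool := ![true, true, false, true, false, false]

/-- For a field of orientations only the continuity across edges has to be checked. -/
theorem isMatched_of_glue {κ : ℤ × ℤ → ZMod 6}
    (glue : ∀ x j, onRight (j + 3 - κ (x + step j)) = true ↔ ¬ onRight (j - κ x) = true) :
    IsMatched (fun x => tileAxis (κ x)) (fun x j => onRight (j - κ x) = true) where
  line x j := by generalize κ x = k; decide +revert
  right x j := by generalize κ x = k; decide +revert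
  left x j := by generalize κ x = k; decide +revert
  glue := glue

/-- Going backwards along the row of direction `j` through `z`, the first tile off the straight
curve turns the black curve to the right. -/
def RightBehind (z : ℤ × ℤ) (j : ZMod 6) : Prop :=
  ∃ t : ℕ, field (z - (t : ℤ) • step j) = axis j - 1 ∧
    ∀ i : ℕ, i < t → field (z - (i : ℤ) • step j) = axis j

theorem rightBehind_iff_of_ne {z : ℤ × ℤ} {j : ZMod 6} (hz : field z ≠ axis j) :
    RightBehind z j ↔ field z = axis j - 1 := by
  constructor
  · rintro ⟨t, h1, h2⟩
    rcases t with _ | t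
    · simpa using h1
    · exact absurd (by simpa using h2 0 (by omega)) hz
  · intro h
    exact ⟨0, by simpa using h, fun i hi => by omega⟩

theorem rightBehind_add_iff {z : ℤ × ℤ} {j : ZMod 6} (hz : field (z + step j) = axis j) :
    RightBehind (z + step j) j ↔ RightBehind z j := by
  have e : ∀ t : ℕ, z + step j - ((t + 1 : ℕ) : ℤ) • step j = z - (t : ℤ) • step j := by
    intro t; push_cast; module
  constructor
  · rintro ⟨t, h1, h2⟩
    rcases t with _ | t
    · rw [Nat.cast_zero, zero_smul, sub_zero, hz] at h1
      generalize axis j = a at h1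
      exact absurd h1 (by decide +revert)
    · exact ⟨t, by rwa [e] at h1, fun i hi => by rw [← e]; exact h2 _ (by omega)⟩
  · rintro ⟨t, h1, h2⟩
    refine ⟨t + 1, by rwa [e], fun i hi => ?_⟩
    rcases i with _ | i
    · simpa using hz
    · rw [e]; exact h2 _ (by omega)

/-- The corner tiles of a row turn the black curve alternately to the right and to the left: the
corner tile before the one at `x = z + step j` is `x - 2 ^ level x • step j`. -/
theorem rightBehind_iff_of_corner {z : ℤ × ℤ} {j : ZMod 6} (hz : field (z + step j) ≠ axis j) :
    RightBehind z j ↔ ¬ field (z + step j) = axis j - 1 := by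
  obtain ⟨x, rfl⟩ : ∃ x, z = x - step j := ⟨z + step j, by abel⟩
  rw [sub_add_cancel] at hz ⊢
  have lines : ∀ t : ℤ, 0 < t → t < 2 ^ level x → field (x - t • step j) = axis j := by
    intro t h0 h1
    have := field_add_of_lt h0 h1 (j + 3)
    rwa [step_add_three, smul_neg, ← sub_eq_add_neg, axis_add_three] at this
  have corner : field (x - (2 ^ level x : ℤ) • step j) = -(field x + axis j) := by
    have := (level_add (z := x) (j := j + 3) (by rwa [axis_add_three])).2
    rwa [step_add_three, smul_neg, ← sub_eq_add_neg, axis_add_three] at this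
  have e : ∀ t : ℕ, x - step j - (t : ℤ) • step j = x - ((t + 1 : ℕ) : ℤ) • step j := by
    intro t; push_cast; module
  have cast : (2 ^ level x : ℤ) = ((2 ^ level x : ℕ) : ℤ) := by push_cast; rfl
  have pos : 0 < 2 ^ level x := by positivity
  have three : ∀ b a : ZMod 3, b ≠ a → (-(b + a) = a - 1 ↔ ¬ b = a - 1) ∧ -(b + a) ≠ a ∧
      a ≠ a - 1 := by decide
  obtain ⟨t1, t2, t3⟩ := three _ _ hz
  rw [cast] at corner lines
  rw [← t1, ← corner]
  constructor
  · rintro ⟨t, h1, h2⟩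
    rw [e] at h1
    rcases lt_trichotomy (t + 1) (2 ^ level x) with hlt | heq | hgt
    · rw [lines _ (by positivity) (by exact_mod_cast hlt)] at h1
      exact absurd h1 t3
    · rwa [heq] at h1
    · have := h2 (2 ^ level x - 1) (by omega)
      rw [e, Nat.sub_add_cancel pos, corner] at this
      exact absurd this t2
  · intro h
    refine ⟨2 ^ level x - 1, by rwa [e, Nat.sub_add_cancel pos], fun i hi => ?_⟩
    rw [e]
    exact lines _ (by positivity) (by exact_mod_cast (by omega : i + 1 < 2 ^ level x))

open Classical in
/-- The orientation of the tile at `z` in the hierarchical tiling. -/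
def orient (z : ℤ × ℤ) : ZMod 6 :=
  let j : ZMod 6 := (![0, 2, 4] : ZMod 3 → ZMod 6) (field z)
  if RightBehind z j then j - 1 else j + 2

theorem tileAxis_orient (z : ℤ × ℤ) : tileAxis (orient z) = field z := by
  have key : ∀ c : ZMod 3, tileAxis ((![0, 2, 4] : ZMod 3 → ZMod 6) c - 1) = c ∧
      tileAxis ((![0, 2, 4] : ZMod 3 → ZMod 6) c + 2) = c := by decide
  unfold orient
  dsimp only
  split_ifs
  · exact (key _).1
  · exact (key _).2

theorem glue_orient_of_even (x : ℤ × ℤ) {j : ZMod 6} (hj : j = 0 ∨ j = 2 ∨ j = 4) :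
    onRight (j + 3 - orient (x + step j)) = true ↔ ¬ onRight (j - orient x) = true := by
  have ev : ∀ z, field z = axis j → (![0, 2, 4] : ZMod 3 → ZMod 6) (field z) = j := by
    intro z hz
    rw [hz]
    rcases hj with rfl | rfl | rfl <;> rfl
  have dec : ∀ j k : ZMod 6, tileAxis k ≠ axis j →
      ((onRight (j - k) = true ↔ tileAxis k = axis j - 1) ∧
        (onRight (j + 3 - k) = true ↔ tileAxis k = axis j - 1)) := by decide
  have e1 : onRight (j - (j - 1)) = true := by rw [sub_sub_cancel]; rfl
  have e2 : onRight (j - (j + 2)) = false := by rw [sub_add_cancel_left]; rfl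
  have e3 : onRight (j + 3 - (j - 1)) = false := by
    rw [show j + 3 - (j - 1) = 4 by ring]; rfl
  have e4 : onRight (j + 3 - (j + 2)) = true := by rw [show j + 3 - (j + 2) = 1 by ring]; rfl
  have own : ∀ z, onRight (j - orient z) = true ↔ RightBehind z j := by
    intro z
    by_cases hz : field z = axis j
    · unfold orient
      rw [ev z hz]
      dsimp only
      split_ifs with hb
      · simp only [hb, e1]
      · simp only [hb, e2, Bool.false_eq_true]
    · rw [rightBehind_iff_of_ne hz, ← tileAxis_orient]
      exact (dec _ _ (by rwa [tileAxis_orient])).1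
  rw [own]
  by_cases hz : field (x + step j) = axis j
  · rw [← rightBehind_add_iff hz]
    unfold orient
    rw [ev _ hz]
    dsimp only
    split_ifs with hb
    · simp only [hb, e3, not_true, Bool.false_eq_true]
    · simp only [hb, e4, not_false_eq_true]
  · rw [(dec _ _ (by rwa [tileAxis_orient])).2, tileAxis_orient, rightBehind_iff_of_corner hz,
      not_not]

theorem glue_orient (x : ℤ × ℤ) (j : ZMod 6) :
    onRight (j + 3 - orient (x + step j)) = true ↔ ¬ onRight (j - orient x) = true := by
  have hj : (j = 0 ∨ j = 2 ∨ j = 4) ∨ (j + 3 = 0 ∨ j + 3 = 2 ∨ j + 3 = 4) := by decide +revert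
  rcases hj with hj | hj
  · exact glue_orient_of_even x hj
  · have := glue_orient_of_even (x + step j) hj
    rw [step_add_three, add_neg_cancel_right, add_assoc j, show (3 : ZMod 6) + 3 = 0 by decide,
      add_zero] at this
    rw [this, not_not]

/-! ### Connectedness of the red trees in the hierarchical field -/

/-- The red trees of the tiles at `x` and at its neighbour `x + step j` both reach their common
edge: a tree avoids exactly the two edges in the directions `j` with `field x = axis j + 1`. -/
def RedAdj (x y : ℤ × ℤ) : Prop :=
  ∃ j, y = x + step j ∧ field x ≠ axis j + 1 ∧ field y ≠ axis j + 1

/-- Lattice points whose tiles are linked by a chain of touching red trees. -/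
abbrev RedConnected : ℤ × ℤ → ℤ × ℤ → Prop := Relation.ReflTransGen RedAdj

theorem RedAdj.symm {x y : ℤ × ℤ} (h : RedAdj x y) : RedAdj y x := by
  obtain ⟨j, rfl, h1, h2⟩ := h
  exact ⟨j + 3, by rw [step_add_three]; abel, by rwa [axis_add_three], by rwa [axis_add_three]⟩

theorem RedConnected.symm {x y : ℤ × ℤ} (h : RedConnected x y) : RedConnected y x := by
  induction h with
  | refl => exact .refl
  | tail _ h ih => exact .head h.symm ih

/-- Red trees are linked along a row that contains no tile of the class avoiding the row. -/
theorem redConnected_row {x : ℤ × ℤ} {j : ZMod 6} (N : ℕ)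
    (h : ∀ i : ℕ, i ≤ N → field (x + (i : ℤ) • step j) ≠ axis j + 1) :
    RedConnected x (x + (N : ℤ) • step j) := by
  induction N with
  | zero => rw [Nat.cast_zero, zero_smul, add_zero]
  | succ N ih =>
    refine (ih fun i hi => h i (by omega)).tail ⟨j, ?_, h N (by omega), ?_⟩
    · push_cast; module
    · exact h (N + 1) le_rfl

theorem axis_ne_add_one (j : ZMod 6) : axis j ≠ axis j + 1 := by decide +revert

theorem redConnected_of_lines {x : ℤ × ℤ} {j : ZMod 6} {N : ℕ} (hN : N ≤ 2 ^ level x)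
    (h0 : field x ≠ axis j + 1) (h1 : field (x + (N : ℤ) • step j) ≠ axis j + 1) :
    RedConnected x (x + (N : ℤ) • step j) := by
  refine redConnected_row N fun i hi => ?_
  rcases Nat.eq_zero_or_pos i with rfl | hpos
  · simpa using h0
  rcases hi.eq_or_lt with rfl | hlt
  · exact h1
  · rw [field_add_of_lt (by exact_mod_cast hpos) (by exact_mod_cast hlt.trans_le hN)]
    exact axis_ne_add_one j

/-- Each tile is linked to a tile of higher level: the straight curve through the tile at `z` has
tiles of higher level at distance `2 ^ level z` on both sides, and not both of them have a tree
avoiding the row. -/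
theorem exists_redConnected_level_lt (z : ℤ × ℤ) : ∃ ε : ℤ, (ε = 1 ∨ ε = -1) ∧ ∃ j,
    level z < level (z + (ε * 2 ^ level z) • step j) ∧
      RedConnected z (z + (ε * 2 ^ level z) • step j) := by
  obtain ⟨j, v, hj, hw⟩ := hasLevel_level z
  have cast : ((2 ^ level z : ℕ) : ℤ) = 2 ^ level z := by push_cast; rfl
  have plus : fromCentre (z + (1 * 2 ^ level z : ℤ) • step j)
      = (2 ^ (level z + 1) : ℤ) • (v + (4 : ℤ) • step j) := by
    rw [fromCentre_add_smul, hw, pow_succ]; module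
  have minus : fromCentre (z + (-1 * 2 ^ level z : ℤ) • step j)
      = (2 ^ (level z + 1) : ℤ) • (v + (4 : ℤ) • step j + (-7 : ℤ) • step j) := by
    rw [fromCentre_add_smul, hw, pow_succ]; module
  have ne1 : v + (4 : ℤ) • step j ≠ 0 := by
    intro h
    rw [h, smul_zero] at plus
    exact fromCentre_ne_zero _ plus
  have higher : ∀ {u y : ℤ × ℤ} {m : ℕ} {c : ZMod 3},
      fromCentre y = (2 ^ (level z + 1) : ℤ) • u → HasLevel u m c →
        level z < level y ∧ field y = c := by
    intro u y m c hy hu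
    have := hu.two_pow_smul (level z + 1)
    rw [← hy] at this
    obtain ⟨l, f⟩ := this.eq
    exact ⟨by omega, f⟩
  obtain ⟨m, c, hm⟩ := exists_hasLevel ne1
  by_cases hc : c = axis j + 1
  · have hne : c ≠ axis j := by rw [hc]; exact (axis_ne_add_one j).symm
    have hl : ∃ m' c', HasLevel (v + (4 : ℤ) • step j + (-7 : ℤ) • step j) m' c' ∧
        c' ≠ axis j + 1 := by
      rcases Nat.eq_zero_or_pos m with rfl | hpos
      · have := hm.add_of_ne (n := -7) (by decide) hne
        rw [pow_zero, one_mul] at this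
        refine ⟨_, _, this, ?_⟩
        rw [hc]; generalize axis j = a; decide +revert
      · have := hm.add_of_lt hpos (n := -7) (by decide) j
        rw [pow_zero, one_mul] at this
        exact ⟨_, _, this, axis_ne_add_one j⟩
    obtain ⟨m', c', hm', hc'⟩ := hl
    obtain ⟨l, f⟩ := higher minus hm'
    have e : (-1 * 2 ^ level z : ℤ) • step j = ((2 ^ level z : ℕ) : ℤ) • step (j + 3) := by
      rw [step_add_three, cast]; module
    refine ⟨-1, Or.inr rfl, j, l, ?_⟩
    rw [e] at f ⊢
    refine redConnected_of_lines le_rfl ?_ ?_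
    · rw [← hj, axis_add_three]; exact axis_ne_add_one j
    · rw [f, axis_add_three]; exact hc'
  · obtain ⟨l, f⟩ := higher plus hm
    refine ⟨1, Or.inl rfl, j, l, ?_⟩
    rw [one_mul, ← cast] at f ⊢
    refine redConnected_of_lines le_rfl ?_ ?_
    · rw [← hj]; exact axis_ne_add_one j
    · rwa [f]

theorem step_bounds (j : ZMod 6) : |(step j).1| ≤ 1 ∧ |(step j).2| ≤ 1 := by decide +revert

theorem exists_redConnected_le_level (z : ℤ × ℤ) (n : ℕ) : ∃ y, RedConnected z y ∧ n ≤ level y ∧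
    |y.1 - z.1| ≤ 2 ^ n - 1 ∧ |y.2 - z.2| ≤ 2 ^ n - 1 := by
  induction n with
  | zero => exact ⟨z, .refl, Nat.zero_le _, by simp, by simp⟩
  | succ n ih =>
    obtain ⟨y, hy, hn, h1, h2⟩ := ih
    have hp : (0 : ℤ) < 2 ^ n := by positivity
    rw [pow_succ]
    rcases hn.eq_or_lt with heq | hlt
    · obtain ⟨ε, hε, j, hl, hc⟩ := exists_redConnected_level_lt y
      rw [← heq] at hl hc
      refine ⟨_, hy.trans hc, hl, ?_, ?_⟩
      all_goals
        obtain ⟨b1, b2⟩ := step_bounds j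
        rw [abs_le] at *
        simp only [Prod.fst_add, Prod.snd_add, Prod.smul_fst, Prod.smul_snd, smul_eq_mul]
        rcases hε with rfl | rfl <;> constructor <;> nlinarith
    · exact ⟨y, hy, hlt, by linarith, by linarith⟩

/-- The similarity with factor `8` about the centre of the hierarchy. -/
def expand (z : ℤ × ℤ) : ℤ × ℤ := (8 : ℤ) • z - (-1, 2)

theorem fromCentre_expand (z : ℤ × ℤ) : fromCentre (expand z) = (2 ^ 3 : ℤ) • fromCentre z := by
  unfold fromCentre expand
  module

theorem level_expand (z : ℤ × ℤ) : level (expand z) = level z + 3 ∧ field (expand z) = field z := by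
  refine HasLevel.eq ?_
  rw [fromCentre_expand]
  exact (hasLevel_level z).two_pow_smul 3

theorem RedConnected.expand {x y : ℤ × ℤ} (h : RedConnected x y) :
    RedConnected (expand x) (expand y) := by
  induction h with
  | refl => exact .refl
  | @tail b _ _ h ih =>
    obtain ⟨j, rfl, h1, h2⟩ := h
    have e : Monotile.expand (b + step j) = Monotile.expand b + ((8 : ℕ) : ℤ) • step j := by
      unfold Monotile.expand; push_cast; module
    have := (level_expand (b + step j)).2
    rw [e] at this ⊢
    refine ih.trans (redConnected_of_lines ?_ ?_ ?_)
    · rw [(level_expand b).1, pow_add]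
      exact Nat.le_mul_of_pos_left 8 (by positivity)
    · rwa [(level_expand b).2]
    · rwa [this]

theorem exists_redConnected_expand (z : ℤ × ℤ) : ∃ y, RedConnected z (expand y) ∧
    |8 * y.1 + 1 - z.1| ≤ 7 ∧ |8 * y.2 - 2 - z.2| ≤ 7 := by
  obtain ⟨x, hx, hl, h1, h2⟩ := exists_redConnected_le_level z 3
  obtain ⟨j, v, -, hw⟩ := hasLevel_level x
  obtain ⟨d, hd⟩ := Nat.exists_eq_add_of_le hl
  rw [hd, pow_add, mul_smul] at hw
  refine ⟨x - (2 ^ d : ℤ) • (step j + (2 : ℤ) • v), ?_⟩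
  have e : expand (x - (2 ^ d : ℤ) • (step j + (2 : ℤ) • v)) = x := by
    unfold expand
    rw [smul_sub, show (8 : ℤ) = 2 ^ 3 by norm_num, ← hw]
    unfold fromCentre
    module
  refine ⟨by rwa [e], ?_, ?_⟩
  · have := congrArg Prod.fst e
    simp only [expand, Prod.fst_sub, Prod.smul_fst, smul_eq_mul] at this ⊢
    rw [show 8 * (x.1 - 2 ^ d * (step j + (2 : ℤ) • v).1) + 1 = x.1 by linarith]
    exact h1
  · have := congrArg Prod.snd e
    simp only [expand, Prod.snd_sub, Prod.smul_snd, smul_eq_mul] at this ⊢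
    rw [show 8 * (x.2 - 2 ^ d * (step j + (2 : ℤ) • v).2) - 2 = x.2 by linarith]
    exact h2

theorem field_eq {z : ℤ × ℤ} (k : ℕ) (j : ZMod 6) (v : ℤ × ℤ)
    (h : fromCentre z = (2 ^ k : ℤ) • (step j + (2 : ℤ) • v)) : field z = axis j :=
  (HasLevel.eq ⟨j, v, rfl, h⟩).2

theorem redConnected_step {x y : ℤ × ℤ} (j : ZMod 6) {a b : ZMod 6} (hx : field x = axis a)
    (hy : field y = axis b) (e : y = x + step j)
    (h : axis a ≠ axis j + 1 ∧ axis b ≠ axis j + 1) : RedConnected x y :=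
  .single ⟨j, e, by rw [hx]; exact h.1, by rw [hy]; exact h.2⟩

/-- The patch around the centre of the hierarchy is linked by explicit chains of red trees. -/
theorem redConnected_patch : RedConnected (expand 0) 0 ∧
    ∀ z : ℤ × ℤ, |z.1| ≤ 1 → |z.2| ≤ 1 → RedConnected z 0 := by
  have fcm7_m2 : field (-7, -2) = axis 1 := field_eq 4 1 (-2, -1) (by decide)
  have fcm6_m2 : field (-6, -2) = axis 0 := field_eq 0 0 (-21, -8) (by decide)
  have fcm6_m1 : field (-6, -1) = axis 1 := field_eq 0 1 (-21, -5) (by decide)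
  have fcm5_m2 : field (-5, -2) = axis 0 := field_eq 1 0 (-9, -4) (by decide)
  have fcm5_0 : field (-5, 0) = axis 1 := field_eq 1 1 (-9, -1) (by decide)
  have fcm4_m2 : field (-4, -2) = axis 0 := field_eq 0 0 (-14, -8) (by decide)
  have fcm4_1 : field (-4, 1) = axis 1 := field_eq 0 1 (-14, 2) (by decide)
  have fcm3_m2 : field (-3, -2) = axis 0 := field_eq 2 0 (-3, -2) (by decide)
  have fcm3_2 : field (-3, 2) = axis 1 := field_eq 2 1 (-3, 1) (by decide)
  have fcm2_m2 : field (-2, -2) = axis 0 := field_eq 0 0 (-7, -8) (by decide)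
  have fcm2_2 : field (-2, 2) = axis 0 := field_eq 0 0 (-7, 6) (by decide)
  have fcm1_m2 : field (-1, -2) = axis 0 := field_eq 1 0 (-2, -4) (by decide)
  have fcm1_m1 : field (-1, -1) = axis 2 := field_eq 0 2 (-3, -5) (by decide)
  have fcm1_0 : field (-1, 0) = axis 1 := field_eq 1 1 (-2, -1) (by decide)
  have fcm1_1 : field (-1, 1) = axis 2 := field_eq 0 2 (-3, 2) (by decide)
  have fcm1_2 : field (-1, 2) = axis 0 := field_eq 1 0 (-2, 3) (by decide)
  have fc0_m2 : field (0, -2) = axis 0 := field_eq 0 0 (0, -8) (by decide)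
  have fc0_m1 : field (0, -1) = axis 1 := field_eq 0 1 (0, -5) (by decide)
  have fc0_0 : field (0, 0) = axis 0 := field_eq 0 0 (0, -1) (by decide)
  have fc0_1 : field (0, 1) = axis 1 := field_eq 0 1 (0, 2) (by decide)
  have fc1_m2 : field (1, -2) = axis 0 := field_eq 3 0 (0, -1) (by decide)
  have fc1_m1 : field (1, -1) = axis 2 := field_eq 0 2 (4, -5) (by decide)
  have fc1_0 : field (1, 0) = axis 2 := field_eq 1 2 (2, -1) (by decide)
  have fc1_1 : field (1, 1) = axis 2 := field_eq 0 2 (4, 2) (by decide)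
  have fc1_2 : field (1, 2) = axis 2 := field_eq 2 2 (1, 1) (by decide)
  have cm1_0 : RedConnected (-1, 0) (0, 0) :=
    (redConnected_step 0 fcm1_0 fc0_0 (by decide) (by decide)).trans .refl
  have c0_1 : RedConnected (0, 1) (0, 0) :=
    (redConnected_step 4 fc0_1 fcm1_0 (by decide) (by decide)).trans cm1_0
  have c1_2 : RedConnected (1, 2) (0, 0) :=
    (redConnected_step 4 fc1_2 fc0_1 (by decide) (by decide)).trans c0_1
  have c1_1 : RedConnected (1, 1) (0, 0) :=
    (redConnected_step 2 fc1_1 fc1_2 (by decide) (by decide)).trans c1_2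
  have c1_0 : RedConnected (1, 0) (0, 0) :=
    (redConnected_step 2 fc1_0 fc1_1 (by decide) (by decide)).trans c1_1
  have c0_m1 : RedConnected (0, -1) (0, 0) :=
    (redConnected_step 1 fc0_m1 fc1_0 (by decide) (by decide)).trans c1_0
  have c1_m1 : RedConnected (1, -1) (0, 0) :=
    (redConnected_step 2 fc1_m1 fc1_0 (by decide) (by decide)).trans c1_0
  have c1_m2 : RedConnected (1, -2) (0, 0) :=
    (redConnected_step 2 fc1_m2 fc1_m1 (by decide) (by decide)).trans c1_m1
  have c0_m2 : RedConnected (0, -2) (0, 0) :=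
    (redConnected_step 0 fc0_m2 fc1_m2 (by decide) (by decide)).trans c1_m2
  have cm1_m2 : RedConnected (-1, -2) (0, 0) :=
    (redConnected_step 0 fcm1_m2 fc0_m2 (by decide) (by decide)).trans c0_m2
  have cm1_m1 : RedConnected (-1, -1) (0, 0) :=
    (redConnected_step 5 fcm1_m1 fcm1_m2 (by decide) (by decide)).trans cm1_m2
  have cm2_m2 : RedConnected (-2, -2) (0, 0) :=
    (redConnected_step 0 fcm2_m2 fcm1_m2 (by decide) (by decide)).trans cm1_m2
  have cm3_m2 : RedConnected (-3, -2) (0, 0) :=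
    (redConnected_step 0 fcm3_m2 fcm2_m2 (by decide) (by decide)).trans cm2_m2
  have cm4_m2 : RedConnected (-4, -2) (0, 0) :=
    (redConnected_step 0 fcm4_m2 fcm3_m2 (by decide) (by decide)).trans cm3_m2
  have cm5_m2 : RedConnected (-5, -2) (0, 0) :=
    (redConnected_step 0 fcm5_m2 fcm4_m2 (by decide) (by decide)).trans cm4_m2
  have cm6_m2 : RedConnected (-6, -2) (0, 0) :=
    (redConnected_step 0 fcm6_m2 fcm5_m2 (by decide) (by decide)).trans cm5_m2
  have cm7_m2 : RedConnected (-7, -2) (0, 0) :=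
    (redConnected_step 0 fcm7_m2 fcm6_m2 (by decide) (by decide)).trans cm6_m2
  have cm6_m1 : RedConnected (-6, -1) (0, 0) :=
    (redConnected_step 4 fcm6_m1 fcm7_m2 (by decide) (by decide)).trans cm7_m2
  have cm5_0 : RedConnected (-5, 0) (0, 0) :=
    (redConnected_step 4 fcm5_0 fcm6_m1 (by decide) (by decide)).trans cm6_m1
  have cm4_1 : RedConnected (-4, 1) (0, 0) :=
    (redConnected_step 4 fcm4_1 fcm5_0 (by decide) (by decide)).trans cm5_0
  have cm3_2 : RedConnected (-3, 2) (0, 0) :=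
    (redConnected_step 4 fcm3_2 fcm4_1 (by decide) (by decide)).trans cm4_1
  have cm2_2 : RedConnected (-2, 2) (0, 0) :=
    (redConnected_step 3 fcm2_2 fcm3_2 (by decide) (by decide)).trans cm3_2
  have cm1_2 : RedConnected (-1, 2) (0, 0) :=
    (redConnected_step 3 fcm1_2 fcm2_2 (by decide) (by decide)).trans cm2_2
  have cm1_1 : RedConnected (-1, 1) (0, 0) :=
    (redConnected_step 2 fcm1_1 fcm1_2 (by decide) (by decide)).trans cm1_2
  refine ⟨c1_m2, ?_⟩
  rintro ⟨a, b⟩ ha hb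
  simp only [abs_le] at ha hb
  obtain ⟨ha1, ha2⟩ := ha
  obtain ⟨hb1, hb2⟩ := hb
  interval_cases a <;> interval_cases b
  exacts [cm1_m1, cm1_0, cm1_1, c0_m1, .refl, c0_1, c1_m1, c1_0, c1_1]

/-- All tiles of the hierarchical tiling are linked: up to a chain of red trees a tile is the image
of a tile closer to the centre under the similarity `expand`, which preserves links. -/
theorem redConnected_zero (z : ℤ × ℤ) : RedConnected z 0 := by
  induction hn : max z.1.natAbs z.2.natAbs using Nat.strong_induction_on generalizing z with
  | _ n ih =>
    by_cases hz : |z.1| ≤ 1 ∧ |z.2| ≤ 1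
    · exact redConnected_patch.2 z hz.1 hz.2
    · obtain ⟨y, hy, h1, h2⟩ := exists_redConnected_expand z
      rw [not_and_or, abs_le, abs_le] at hz
      rw [abs_le] at h1 h2
      have hlt : max y.1.natAbs y.2.natAbs < n := by omega
      exact hy.trans ((ih _ hlt y rfl).expand.trans redConnected_patch.1)

theorem redConnected (x y : ℤ × ℤ) : RedConnected x y :=
  (redConnected_zero x).trans (redConnected_zero y).symm

/-! ### The hexagon and its decoration -/

/-- The sixth root of unity in direction `j`. -/
def dir (j : ZMod 6) : ℂ := ω ^ j.val

theorem sqrt_three_mul_self : Real.sqrt 3 * Real.sqrt 3 = 3 := Real.mul_self_sqrt (by norm_num)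

theorem ω_sq : ω ^ 2 = ω - 1 := by
  have := sqrt_three_mul_self
  rw [sq]
  apply Complex.ext <;> simp [ω] <;> nlinarith

theorem ω_cube : ω ^ 3 = -1 := by
  linear_combination (ω + 1) * ω_sq

theorem ω_pow_six : ω ^ 6 = 1 := by
  linear_combination (ω ^ 3 - 1) * ω_cube

theorem dir_add (i j : ZMod 6) : dir (i + j) = dir i * dir j := by
  unfold dir
  rw [ZMod.val_add, ← pow_add, ← pow_eq_pow_mod _ ω_pow_six]

theorem dir_zero : dir 0 = 1 := pow_zero _

theorem dir_three : dir 3 = -1 := ω_cube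

theorem dir_add_three (j : ZMod 6) : dir (j + 3) = -dir j := by rw [dir_add, dir_three]; ring

theorem dir_one : dir 1 = ⟨1 / 2, Real.sqrt 3 / 2⟩ := pow_one _

theorem dir_two : dir 2 = ⟨-(1 / 2), Real.sqrt 3 / 2⟩ := by
  rw [show dir 2 = ω - 1 from ω_sq]
  apply Complex.ext <;> simp [ω]
  norm_num

theorem norm_dir (j : ZMod 6) : ‖dir j‖ = 1 := by
  have h : ‖ω‖ = 1 := by
    rw [← sq_eq_sq₀ (norm_nonneg _) zero_le_one, Complex.sq_norm, Complex.normSq_apply]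
    simp only [ω]
    linear_combination sqrt_three_mul_self / 4
  rw [dir, norm_pow, h, one_pow]

theorem dir_mul_dir_neg (j : ZMod 6) : dir j * dir (-j) = 1 := by
  rw [← dir_add, add_neg_cancel, dir_zero]

theorem conj_dir (j : ZMod 6) : (starRingEnd ℂ) (dir j) = dir (-j) := by
  have h1 : dir j * (starRingEnd ℂ) (dir j) = 1 := by
    rw [Complex.mul_conj, Complex.normSq_eq_norm_sq, norm_dir]; norm_num
  have h2 := dir_mul_dir_neg j
  have h0 : dir j ≠ 0 := left_ne_zero_of_mul_eq_one h1
  exact mul_left_cancel₀ h0 (h1.trans h2.symm)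

/-- The height of a point of the plane above the origin in direction `k`. -/
def height (k : ZMod 6) (w : ℂ) : ℝ := (w * dir (-k)).re

theorem height_add (k : ZMod 6) (v w : ℂ) : height k (v + w) = height k v + height k w := by
  simp [height, add_mul]

theorem height_sub (k : ZMod 6) (v w : ℂ) : height k (v - w) = height k v - height k w := by
  simp [height, sub_mul]

theorem height_smul (k : ZMod 6) (r : ℝ) (w : ℂ) : height k (r * w) = r * height k w := by
  simp [height, mul_assoc]

theorem height_add_three (k : ZMod 6) (w : ℂ) : height (k + 3) w = -height k w := by
  rw [height, show -(k + 3) = -k + 3 by rw [neg_add]; rfl, dir_add_three]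
  simp [height]

theorem height_dir_mul (k i : ZMod 6) (w : ℂ) : height k (dir i * w) = height (k - i) w := by
  rw [height, height, show -(k - i) = i + -k by ring, dir_add]
  congr 1
  ring

theorem height_dir (k i : ZMod 6) : height k (dir i) = (dir (i - k)).re := by
  rw [height, ← dir_add, sub_eq_add_neg]

theorem height_dir_self (k : ZMod 6) : height k (dir k) = 1 := by
  rw [height_dir, sub_self, dir_zero, Complex.one_re]

theorem height_le_norm (k : ZMod 6) (w : ℂ) : height k w ≤ ‖w‖ := by
  have := Complex.re_le_norm (w * dir (-k))
  rwa [norm_mul, norm_dir, mul_one] at this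

theorem continuous_height (k : ZMod 6) : Continuous (height k) := by
  unfold height
  fun_prop

theorem height_zero (w : ℂ) : height 0 w = w.re := by simp [height, dir_zero]

theorem height_one (w : ℂ) : height 1 w = w.re / 2 + Real.sqrt 3 * w.im / 2 := by
  rw [height, ← conj_dir, dir_one]
  simp
  ring

theorem height_two (w : ℂ) : height 2 w = -w.re / 2 + Real.sqrt 3 * w.im / 2 := by
  rw [height, ← conj_dir, dir_two]
  simp
  ring

theorem mem_hexagon {w : ℂ} : w ∈ hexagon ↔ ∀ k, height k w ≤ 1 / 2 := by
  unfold height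
  simp only [← conj_dir]
  rfl

theorem mem_hexagon_iff_abs {w : ℂ} : w ∈ hexagon ↔
    |height 0 w| ≤ 1 / 2 ∧ |height 1 w| ≤ 1 / 2 ∧ |height 2 w| ≤ 1 / 2 := by
  have h3 := height_add_three 0 w
  have h4 := height_add_three 1 w
  have h5 := height_add_three 2 w
  rw [mem_hexagon]
  simp only [abs_le]
  constructor
  · intro h
    have h3' := h (0 + 3)
    have h4' := h (1 + 3)
    have h5' := h (2 + 3)
    rw [h3] at h3'
    rw [h4] at h4'
    rw [h5] at h5'
    exact ⟨⟨by linarith, h 0⟩, ⟨by linarith, h 1⟩, ⟨by linarith, h 2⟩⟩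
  · rintro ⟨h0, h1, h2⟩ k
    have hk : k = 0 ∨ k = 1 ∨ k = 2 ∨ k = 0 + 3 ∨ k = 1 + 3 ∨ k = 2 + 3 := by decide +revert
    rcases hk with rfl | rfl | rfl | rfl | rfl | rfl 
    · exact h0.2
    · exact h1.2
    · exact h2.2
    · rw [h3]; linarith
    · rw [h4]; linarith
    · rw [h5]; linarith

theorem dir_mul_mem_hexagon {w : ℂ} (i : ZMod 6) : dir i * w ∈ hexagon ↔ w ∈ hexagon := by
  simp only [mem_hexagon, height_dir_mul]
  exact ⟨fun h k => by simpa using h (k + i), fun h k => h _⟩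

theorem normSq_le_of_mem_hexagon {w : ℂ} (h : w ∈ hexagon) : Complex.normSq w ≤ 1 / 3 := by
  obtain ⟨h0, h1, h2⟩ := mem_hexagon_iff_abs.1 h
  have e : Complex.normSq w
      = 2 / 3 * (height 0 w ^ 2 + height 1 w ^ 2 + height 2 w ^ 2) := by
    rw [Complex.normSq_apply, height_zero, height_one, height_two]
    linear_combination (-(w.im * w.im) / 3) * sqrt_three_mul_self
  have s : height 1 w = height 0 w + height 2 w := by
    rw [height_zero, height_one, height_two]; ring
  rw [e]
  rw [s] at h1 ⊢
  rw [abs_le] at h0 h1 h2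
  have key : ∀ a c : ℝ, -(1 / 2) ≤ a → a ≤ 1 / 2 → -(1 / 2) ≤ c → c ≤ 1 / 2 →
      -(1 / 2) ≤ a + c → a + c ≤ 1 / 2 → a ^ 2 + (a + c) ^ 2 + c ^ 2 ≤ 1 / 2 := by
    intro a c a0 a1 c0 c1 s0 s1
    have ha := mul_nonneg (sub_nonneg.2 a0) (sub_nonneg.2 a1)
    have hc := mul_nonneg (sub_nonneg.2 c0) (sub_nonneg.2 c1)
    have hs := mul_nonneg (sub_nonneg.2 s0) (sub_nonneg.2 s1)
    -- Two of `a`, `c`, `-(a + c)` have the same sign, and the square of the third dominates.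
    rcases le_total 0 a with h1 | h1 <;> rcases le_total 0 c with h2 | h2 <;>
      rcases le_total 0 (a + c) with h3 | h3
    · nlinarith [mul_nonneg h1 h2]
    · nlinarith [mul_nonneg h1 h2]
    · nlinarith [mul_nonneg (neg_nonneg.2 h2) h3]
    · nlinarith [mul_nonneg h1 (neg_nonneg.2 h3)]
    · nlinarith [mul_nonneg (neg_nonneg.2 h1) h3]
    · nlinarith [mul_nonneg h2 (neg_nonneg.2 h3)]
    · nlinarith [mul_nonneg (neg_nonneg.2 h1) (neg_nonneg.2 h2)]
    · nlinarith [mul_nonneg (neg_nonneg.2 h1) (neg_nonneg.2 h2)]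
  have := key _ _ h0.1 h0.2 h2.1 h2.2 h1.1 h1.2
  linarith

/-- The point where the black curves of the prototile leave through edge `k`. -/
theorem mark_eq (k : ZMod 6) :
    mark k = dir k * (1 / 2 + ((if onRight k then -1 else 1 : ℝ) / 8 : ℝ) * Complex.I) := by
  have : offset k = if onRight k then -1 else 1 := by
    have h : ∀ k : Fin 6, offset k = if onRight k then -1 else 1 := by
      intro k
      fin_cases k <;> simp [offset, onRight]
    exact h k
  rw [← this]
  rfl

theorem re_dir_le {j : ZMod 6} (hj : j ≠ 0) : (dir j).re ≤ 1 / 2 := by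
  have hk : j = 1 ∨ j = 2 ∨ j = 0 + 3 ∨ j = 1 + 3 ∨ j = 2 + 3 := by decide +revert
  rcases hk with rfl | rfl | rfl | rfl | rfl <;>
    simp only [dir_add_three, dir_zero, dir_one, dir_two, Complex.neg_re, Complex.one_re] <;>
    norm_num

theorem abs_im_dir_le (j : ZMod 6) : |(dir j).im| ≤ 1 :=
  (Complex.abs_im_le_norm _).trans (norm_dir j).le

theorem height_mark_self (k : ZMod 6) : height k (mark k) = 1 / 2 := by
  rw [mark_eq, height_dir_mul, sub_self, height_zero]
  simp

theorem height_mark_lt {k l : ZMod 6} (h : l ≠ k) : height l (mark k) < 1 / 2 := by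
  rw [mark_eq, height_dir_mul, height]
  rw [neg_sub]
  have h1 := re_dir_le (j := k - l) (by rwa [sub_ne_zero, ne_comm])
  have h2 := abs_le.1 (abs_im_dir_le (k - l))
  split_ifs <;> simp <;> linarith

theorem height_mark_le (k l : ZMod 6) : height l (mark k) ≤ 1 / 2 := by
  by_cases h : l = k
  · rw [h, height_mark_self]
  · exact (height_mark_lt h).le

theorem eq_mark_of_mem_segment {i j l : ZMod 6} {w : ℂ} (hw : w ∈ segment ℝ (mark i) (mark j)) :
    height l w ≤ 1 / 2 ∧ (height l w = 1 / 2 → w = mark l) := by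
  obtain ⟨a, b, ha, hb, hab, rfl⟩ := hw
  have e : height l (a • mark i + b • mark j) = a * height l (mark i) + b * height l (mark j) := by
    rw [height_add, Complex.real_smul, Complex.real_smul, height_smul, height_smul]
  have hi := height_mark_le i l
  have hj := height_mark_le j l
  rw [e]
  refine ⟨by nlinarith, fun h => ?_⟩
  by_cases h1 : l = i
  · by_cases h2 : l = j
    · rw [← h1, ← h2, ← add_smul, hab, one_smul]
    · have hlt := height_mark_lt h2
      have : b = 0 := by
        by_contra hne
        have hpos := lt_of_le_of_ne hb (Ne.symm hne)
        nlinarith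
      rw [this, show a = 1 by linarith, h1]
      simp
  · have hlt := height_mark_lt h1
    have : a = 0 := by
      by_contra hne
      have hpos := lt_of_le_of_ne ha (Ne.symm hne)
      nlinarith
    have hb1 : b = 1 := by linarith
    rw [this, hb1] at h ⊢
    by_cases h2 : l = j
    · rw [h2]; simp
    · have := height_mark_lt h2
      linarith

theorem protoBlack_subset_hexagon : protoBlack ⊆ hexagon := by
  intro w hw
  rw [mem_hexagon]
  intro l
  rcases hw with (hw | hw) | hw
  · exact (eq_mark_of_mem_segment (i := 1) (j := 4) hw).1
  · exact (eq_mark_of_mem_segment (i := 2) (j := 3) hw).1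
  · exact (eq_mark_of_mem_segment (i := 5) (j := 0) hw).1

theorem mark_mem_protoBlack (l : ZMod 6) : mark l ∈ protoBlack := by
  have hl : l = 0 ∨ l = 1 ∨ l = 2 ∨ l = 3 ∨ l = 4 ∨ l = 5 := by decide +revert
  rcases hl with rfl | rfl | rfl | rfl | rfl | rfl
  · exact Or.inr (right_mem_segment ℝ _ _)
  · exact Or.inl (Or.inl (left_mem_segment ℝ _ _))
  · exact Or.inl (Or.inr (left_mem_segment ℝ _ _))
  · exact Or.inl (Or.inr (right_mem_segment ℝ _ _))
  · exact Or.inl (Or.inl (right_mem_segment ℝ _ _))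
  · exact Or.inr (left_mem_segment ℝ _ _)

/-- The black curves of a tile reach an edge only at its mark. -/
theorem mem_protoBlack_iff_of_height {w : ℂ} {l : ZMod 6} (h : height l w = 1 / 2) :
    w ∈ protoBlack ↔ w = mark l := by
  refine ⟨?_, fun e => e ▸ mark_mem_protoBlack l⟩
  rintro ((hw | hw) | hw)
  · exact (eq_mark_of_mem_segment (i := 1) (j := 4) hw).2 h
  · exact (eq_mark_of_mem_segment (i := 2) (j := 3) hw).2 h
  · exact (eq_mark_of_mem_segment (i := 5) (j := 0) hw).2 h

/-- The point of edge `j` at distance `1 / 8` from its midpoint, on the right or on the left seen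
from the centre. -/
def edgePoint (j : ZMod 6) (r : Bool) : ℂ :=
  dir j * (1 / 2 + ((if r then -1 else 1 : ℝ) / 8 : ℝ) * Complex.I)

theorem rotate_mem_protoBlack_iff {v : ℂ} {j k : ZMod 6} (h : height j v = 1 / 2) :
    dir (-k) * v ∈ protoBlack ↔ v = edgePoint j (onRight (j - k)) := by
  have e : edgePoint j (onRight (j - k)) = dir k * mark (j - k) := by
    rw [mark_eq, edgePoint, ← mul_assoc, ← dir_add, add_sub_cancel]
  rw [mem_protoBlack_iff_of_height (l := j - k) (by rw [height_dir_mul]; simpa using h), e]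
  have h1 := dir_mul_dir_neg k
  constructor
  · intro h2
    rw [← h2, ← mul_assoc, h1, one_mul]
  · rintro rfl
    rw [← mul_assoc, mul_comm (dir (-k)), h1, one_mul]

/-- On the common edge of adjacent tiles, the right of one is the left of the other. -/
theorem edgePoint_sub_dir (j : ZMod 6) (r : Bool) :
    edgePoint j r - dir j = edgePoint (j + 3) (!r) := by
  cases r <;> simp [edgePoint, dir_add_three] <;> ring

theorem edgePoint_injective (j : ZMod 6) : Function.Injective (edgePoint j) := by
  have hd : dir j ≠ 0 := left_ne_zero_of_mul_eq_one (dir_mul_dir_neg j)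
  intro r r' h
  have h1 := congrArg Complex.im (mul_left_cancel₀ hd h)
  cases r <;> cases r' <;> simp at h1 ⊢ <;> norm_num at h1

theorem height_edgePoint (j : ZMod 6) (r : Bool) : height j (edgePoint j r) = 1 / 2 := by
  rw [edgePoint, height_dir_mul, sub_self, height_zero]
  simp

/-! ### The triangular lattice in the plane -/

/-- The lattice point with coordinates `x` with respect to the basis `1, ω ^ 2`. -/
def point (x : ℤ × ℤ) : ℂ := x.1 + x.2 * dir 2

theorem point_add (x y : ℤ × ℤ) : point (x + y) = point x + point y := by
  simp [point]; ring

theorem point_smul (n : ℤ) (x : ℤ × ℤ) : point (n • x) = n * point x := by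
  simp [point]; ring

theorem point_step (j : ZMod 6) : point (step j) = dir j := by
  have h1 : dir 1 = 1 + dir 2 := by
    rw [dir_one, dir_two]
    apply Complex.ext <;> simp
    norm_num
  have h4 : dir 4 = -dir 1 := dir_add_three 1
  have h5 : dir 5 = -dir 2 := dir_add_three 2
  have hj : j = 0 ∨ j = 1 ∨ j = 2 ∨ j = 3 ∨ j = 4 ∨ j = 5 := by decide +revert
  rcases hj with rfl | rfl | rfl | rfl | rfl | rfl
  · simp [point, step, dir_zero]
  · simp [point, step, h1]
  · simp [point, step]
  · simp [point, step, dir_three]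
  · simp [point, step, h4, h1]; ring
  · simp [point, step, h5]

theorem height_point (x : ℤ × ℤ) : height 0 (point x) = (2 * x.1 - x.2 : ℤ) / 2 ∧
    height 1 (point x) = (x.1 + x.2 : ℤ) / 2 ∧ height 2 (point x) = (2 * x.2 - x.1 : ℤ) / 2 := by
  have s := sqrt_three_mul_self
  rw [height_zero, height_one, height_two, point, dir_two]
  simp
  refine ⟨by ring, ?_, ?_⟩
  · linear_combination (x.2 : ℝ) / 4 * s
  · linear_combination (x.2 : ℝ) / 4 * s

theorem point_injective : Function.Injective point := by
  intro x y h
  have hx := height_point x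
  have hy := height_point y
  rw [← h] at hy
  have h1 := hx.2.1.symm.trans hy.2.1
  have h0 := hx.1.symm.trans hy.1
  rw [div_left_inj' (by norm_num), Int.cast_inj] at h0 h1
  ext <;> omega

/-- The hexagons centred at the lattice points cover the plane. -/
theorem exists_sub_point_mem_hexagon (w : ℂ) : ∃ x, w - point x ∈ hexagon := by
  have s := sqrt_three_mul_self
  have spos : Real.sqrt 3 ≠ 0 := by positivity
  -- The real coordinates of `w` with respect to the basis of the lattice.
  obtain ⟨v, hv⟩ : ∃ v : ℝ, v = 2 * w.im / Real.sqrt 3 := ⟨_, rfl⟩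
  obtain ⟨u, hu⟩ : ∃ u : ℝ, u = w.re + v / 2 := ⟨_, rfl⟩
  have him : Real.sqrt 3 * w.im = 3 / 2 * v := by
    rw [hv]; field_simp; rw [sq, s]; ring
  have hre : w.re = u - v / 2 := by linarith
  have key : ∀ a b : ℤ, |2 * (u - a) - (v - b)| ≤ 1 → |(u - a) + (v - b)| ≤ 1 →
      |2 * (v - b) - (u - a)| ≤ 1 → w - point (a, b) ∈ hexagon := by
    intro a b h0 h1 h2
    obtain ⟨p0, p1, p2⟩ := height_point (a, b)
    push_cast at p0 p1 p2
    rw [abs_le] at h0 h1 h2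
    rw [mem_hexagon_iff_abs, height_sub, height_sub, height_sub, p0, p1, p2, height_zero,
      height_one, height_two, him, hre]
    simp only [abs_le]
    refine ⟨⟨?_, ?_⟩, ⟨?_, ?_⟩, ⟨?_, ?_⟩⟩ <;> linarith
  have u0 := Int.floor_le u
  have u1 := Int.lt_floor_add_one u
  have v0 := Int.floor_le v
  have v1 := Int.lt_floor_add_one v
  have corner : ∀ a b : ℤ, |2 * (u - (⌊u⌋ + a : ℤ)) - (v - (⌊v⌋ + b : ℤ))| ≤ 1 →
      |(u - (⌊u⌋ + a : ℤ)) + (v - (⌊v⌋ + b : ℤ))| ≤ 1 →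
      |2 * (v - (⌊v⌋ + b : ℤ)) - (u - (⌊u⌋ + a : ℤ))| ≤ 1 → ∃ x, w - point x ∈ hexagon :=
    fun a b h0 h1 h2 => ⟨_, key _ _ h0 h1 h2⟩
  have t00 := corner 0 0
  have t10 := corner 1 0
  have t01 := corner 0 1
  have t11 := corner 1 1
  clear corner key
  push_cast at t00 t10 t01 t11
  simp only [abs_le] at t00 t10 t01 t11
  obtain ⟨p, hp⟩ : ∃ p : ℝ, p = u - ⌊u⌋ := ⟨_, rfl⟩
  obtain ⟨q, hq⟩ : ∃ q : ℝ, q = v - ⌊v⌋ := ⟨_, rfl⟩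
  have t (a b : ℝ) : u - (⌊u⌋ + a) = p - a := by rw [hp]; ring
  have t' (a b : ℝ) : v - (⌊v⌋ + b) = q - b := by rw [hq]; ring
  simp only [t _ 0, t' 0] at t00 t10 t01 t11
  have p0 : 0 ≤ p := by linarith
  have p1 : p < 1 := by linarith
  have q0 : 0 ≤ q := by linarith
  have q1 : q < 1 := by linarith
  -- The hexagon around one of the four corners of the fundamental parallelogram contains `w`.
  rcases le_total (p + q) 1 with h1 | h1
  · rcases le_total (2 * p - q) 1 with h2 | h2
    · rcases le_total (2 * q - p) 1 with h3 | h3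
      · exact t00 ⟨by linarith, by linarith⟩ ⟨by linarith, by linarith⟩
          ⟨by linarith, by linarith⟩
      · exact t01 ⟨by linarith, by linarith⟩ ⟨by linarith, by linarith⟩
          ⟨by linarith, by linarith⟩
    · exact t10 ⟨by linarith, by linarith⟩ ⟨by linarith, by linarith⟩
        ⟨by linarith, by linarith⟩
  · rcases le_total (2 * q) p with h2 | h2
    · exact t10 ⟨by linarith, by linarith⟩ ⟨by linarith, by linarith⟩
        ⟨by linarith, by linarith⟩
    · rcases le_total (2 * p) q with h3 | h3
      · exact t01 ⟨by linarith, by linarith⟩ ⟨by linarith, by linarith⟩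
          ⟨by linarith, by linarith⟩
      · exact t11 ⟨by linarith, by linarith⟩ ⟨by linarith, by linarith⟩
          ⟨by linarith, by linarith⟩

/-- Hexagons centred at two lattice points meet only if these are adjacent, and then only in the
common edge. -/
theorem exists_step_of_mem_hexagon {w : ℂ} {x y : ℤ × ℤ} (hxy : x ≠ y)
    (hx : w - point x ∈ hexagon) (hy : w - point y ∈ hexagon) :
    ∃ j, y = x + step j ∧ height j (w - point x) = 1 / 2 := by
  obtain ⟨d, rfl⟩ : ∃ d, y = x + d := ⟨y - x, by abel⟩
  have hd : d ≠ 0 := by rintro rfl; simp at hxy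
  have e : w - point (x + d) = w - point x - point d := by rw [point_add]; ring
  rw [e] at hy
  obtain ⟨p0, p1, p2⟩ := height_point d
  have hx' := mem_hexagon_iff_abs.1 hx
  have hy' := mem_hexagon_iff_abs.1 hy
  simp only [height_sub _ _ (point d), p0, p1, p2, abs_le] at hx' hy'
  have bound : ∀ (t : ℝ) (m : ℤ), (-(1 / 2) ≤ t ∧ t ≤ 1 / 2) →
      (-(1 / 2) ≤ t - m / 2 ∧ t - m / 2 ≤ 1 / 2) → -2 ≤ m ∧ m ≤ 2 := by
    rintro t m ⟨a, b⟩ ⟨c, d⟩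
    constructor
    · have : (-2 : ℝ) ≤ m := by linarith
      exact_mod_cast this
    · have : (m : ℝ) ≤ 2 := by linarith
      exact_mod_cast this
  have b0 := bound _ _ hx'.1 hy'.1
  have b1 := bound _ _ hx'.2.1 hy'.2.1
  have b2 := bound _ _ hx'.2.2 hy'.2.2
  have hj : ∃ j, d = step j := by
    rcases d with ⟨m, n⟩
    simp only at b0 b1 b2
    have hm : -1 ≤ m ∧ m ≤ 1 := by omega
    have hn : -1 ≤ n ∧ n ≤ 1 := by omega
    obtain ⟨hm0, hm1⟩ := hm
    obtain ⟨hn0, hn1⟩ := hn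
    interval_cases m <;> interval_cases n <;> first
      | omega
      | exact absurd rfl hd
      | decide
  obtain ⟨j, rfl⟩ := hj
  refine ⟨j, rfl, le_antisymm (mem_hexagon.1 hx j) ?_⟩
  have := mem_hexagon.1 hy (j + 3)
  rw [height_add_three, point_step, height_sub, height_dir_self] at this
  linarith

/-! ### Rigidity of tilings by regular hexagons -/

theorem conj_mul_self_circle (u : Circle) : (starRingEnd ℂ) (u : ℂ) * u = 1 := by
  rw [← Circle.coe_inv_eq_conj, ← Circle.coe_mul, inv_mul_cancel, Circle.coe_one]

theorem conj_mul_self_of_norm {r : ℂ} (hr : ‖r‖ = 1) : (starRingEnd ℂ) r * r = 1 := by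
  rw [mul_comm, Complex.mul_conj, Complex.normSq_eq_norm_sq, hr]
  norm_num

theorem norm_rot_mul_dir (u : Circle) (k : ZMod 6) : ‖(u : ℂ) * dir k‖ = 1 := by
  rw [norm_mul, norm_dir, Circle.norm_coe, one_mul]

/-- The coordinate of `z` in the frame at the centre of `t` whose first axis points through
edge `k`. -/
def Tile.frame (t : Tile) (k : ZMod 6) (z : ℂ) : ℂ :=
  (starRingEnd ℂ) (t.rot * dir k) * (z - t.centre)

theorem Tile.mem_hex_iff (t : Tile) (k : ZMod 6) (z : ℂ) : z ∈ t.hex ↔ t.frame k z ∈ hexagon := by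
  have h1 := conj_mul_self_circle t.rot
  have h2 := dir_mul_dir_neg k
  have e : t.frame k z = dir (-k) * ((starRingEnd ℂ) (t.rot : ℂ) * (z - t.centre)) := by
    rw [Tile.frame, map_mul, conj_dir]; ring
  rw [e, dir_mul_mem_hexagon]
  constructor
  · rintro ⟨w, hw, rfl⟩
    rwa [Tile.isometry, add_sub_cancel_right, ← mul_assoc, h1, one_mul]
  · intro h
    refine ⟨_, h, ?_⟩
    rw [Tile.isometry]
    linear_combination (z - t.centre) * h1

theorem Tile.continuous_frame (t : Tile) (k : ZMod 6) : Continuous (t.frame k) := by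
  unfold Tile.frame
  fun_prop

theorem Tile.norm_frame (t : Tile) (k : ZMod 6) (z : ℂ) : ‖t.frame k z‖ = ‖z - t.centre‖ := by
  rw [Tile.frame, norm_mul, RCLike.norm_conj, norm_rot_mul_dir, one_mul]

theorem Tile.frame_add_smul (t : Tile) (k : ZMod 6) (z : ℂ) (ε : ℝ) (w : ℂ) :
    t.frame k (z + ε * w) = t.frame k z + ε * ((starRingEnd ℂ) (t.rot * dir k) * w) := by
  unfold Tile.frame
  ring

theorem Tile.isClosed_hex (t : Tile) : IsClosed t.hex := by
  have : t.hex = ⋂ k, {z | height k (t.frame 0 z) ≤ 1 / 2} := by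
    ext z
    rw [t.mem_hex_iff 0, mem_hexagon]
    simp
  rw [this]
  exact isClosed_iInter fun k =>
    isClosed_le ((continuous_height k).comp (t.continuous_frame 0)) continuous_const

/-- Boundary points of a tile lie on one of its edges. -/
theorem Tile.exists_height_eq (t : Tile) {z : ℂ} (hz : z ∈ t.hex) (hf : z ∈ frontier t.hex) :
    ∃ k, height k (t.frame 0 z) = 1 / 2 := by
  by_contra! hne
  have hlt : ∀ k, height k (t.frame 0 z) < 1 / 2 := fun k =>
    lt_of_le_of_ne (mem_hexagon.1 ((t.mem_hex_iff 0 z).1 hz) k) (hne k)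
  have hop : IsOpen (⋂ k, {z | height k (t.frame 0 z) < 1 / 2}) :=
    isOpen_iInter_of_finite fun k =>
      isOpen_lt ((continuous_height k).comp (t.continuous_frame 0)) continuous_const
  have hsub : (⋂ k, {z | height k (t.frame 0 z) < 1 / 2}) ⊆ t.hex := by
    intro y hy
    rw [t.mem_hex_iff 0, mem_hexagon]
    exact fun k => (mem_iInter.1 hy k).le
  exact hf.2 (interior_maximal hsub hop (mem_iInter.2 hlt))

/-- Points of an edge of a tile belong to its boundary. -/
theorem Tile.mem_frontier (t : Tile) {z : ℂ} {k : ZMod 6} (hz : z ∈ t.hex)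
    (hk : height k (t.frame 0 z) = 1 / 2) : z ∈ frontier t.hex := by
  refine ⟨subset_closure hz, fun hi => ?_⟩
  have hc : Continuous fun ε : ℝ => z + ε * (t.rot * dir k : ℂ) := by fun_prop
  have hn : ∀ᶠ ε : ℝ in 𝓝 0, z + ε * (t.rot * dir k : ℂ) ∈ t.hex := by
    refine hc.continuousAt.eventually ?_
    simpa using mem_interior_iff_mem_nhds.1 hi
  obtain ⟨ε, hε, hpos⟩ := ((hn.filter_mono nhdsWithin_le_nhds).and
    (self_mem_nhdsWithin : Ioi (0 : ℝ) ∈ 𝓝[>] 0)).exists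
  have h1 := mem_hexagon.1 ((t.mem_hex_iff 0 _).1 hε) k
  have e : (starRingEnd ℂ) (t.rot * dir 0) * (t.rot * dir k) = dir k := by
    rw [dir_zero, mul_one, ← mul_assoc, conj_mul_self_circle, one_mul]
  rw [t.frame_add_smul, height_add, height_smul, hk, e, height_dir_self] at h1
  have : (0 : ℝ) < ε := hpos
  linarith

section Honeycomb

variable {T : Set Tile}

/-- Distinct tiles contain disjoint discs of radius `1 / 2`. -/
theorem IsTiling.one_le_norm (hT : IsTiling T) {t t' : Tile} (ht : t ∈ T) (ht' : t' ∈ T)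
    (hne : t ≠ t') : 1 ≤ ‖t.centre - t'.centre‖ := by
  by_contra! hlt
  set z : ℂ := (t.centre + t'.centre) / 2 with hz
  have half : ‖(t.centre - t'.centre) / 2‖ < 1 / 2 := by
    rw [norm_div, Complex.norm_ofNat]; linarith
  have h1 : ‖z - t.centre‖ < 1 / 2 := by
    rw [show z - t.centre = -((t.centre - t'.centre) / 2) by rw [hz]; ring, norm_neg]
    exact half
  have h2 : ‖z - t'.centre‖ < 1 / 2 := by
    rw [show z - t'.centre = (t.centre - t'.centre) / 2 by rw [hz]; ring]
    exact half
  have key : ∀ s : Tile, ‖z - s.centre‖ < 1 / 2 → ∀ k, height k (s.frame 0 z) < 1 / 2 :=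
    fun s hs k => (height_le_norm k _).trans_lt (by rwa [s.norm_frame])
  have m1 : z ∈ t.hex := (t.mem_hex_iff 0 z).2 (mem_hexagon.2 fun k => (key t h1 k).le)
  have m2 : z ∈ t'.hex := (t'.mem_hex_iff 0 z).2 (mem_hexagon.2 fun k => (key t' h2 k).le)
  obtain ⟨k, hk⟩ := t.exists_height_eq m1 (hT.2 t ht t' ht' hne ⟨m1, m2⟩).1
  exact absurd hk (key t h1 k).ne

theorem Tile.normSq_sub_centre_le (t : Tile) {z : ℂ} (hz : z ∈ t.hex) (k : ZMod 6) :
    Complex.normSq (t.frame k z) ≤ 1 / 3 :=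
  normSq_le_of_mem_hexagon ((t.mem_hex_iff k z).1 hz)

theorem Tile.norm_sub_centre_lt (t : Tile) {z : ℂ} (hz : z ∈ t.hex) : ‖z - t.centre‖ < 1 := by
  have := t.normSq_sub_centre_le hz 0
  rw [Complex.normSq_eq_norm_sq, t.norm_frame] at this
  nlinarith [norm_nonneg (z - t.centre)]

/-- Since tilings are locally finite, the directions at a point are covered by the tiles through
that point. -/
theorem IsTiling.exists_mem_direction (hT : IsTiling T) (z w : ℂ) :
    ∃ t ∈ T, z ∈ t.hex ∧ ∃ ε : ℝ, 0 < ε ∧ z + ε * w ∈ t.hex := by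
  set f : ℕ → ℂ := fun n => z + ((1 / ((n : ℝ) + 1) : ℝ) : ℂ) * w with hf
  have hlim : Tendsto f atTop (𝓝 z) := by
    have h1 := tendsto_one_div_add_atTop_nhds_zero_nat (𝕜 := ℝ)
    have h2 : Tendsto (fun n : ℕ => ((1 / ((n : ℝ) + 1) : ℝ) : ℂ)) atTop (𝓝 ((0 : ℝ) : ℂ)) :=
      (Complex.continuous_ofReal.tendsto 0).comp h1
    simpa [hf] using (h2.mul_const w).const_add z
  have hcov : ∀ n, ∃ t ∈ T, f n ∈ t.hex := by
    intro n
    have : f n ∈ ⋃ t ∈ T, t.hex := hT.1 ▸ mem_univ _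
    simpa using this
  choose t htT htm using hcov
  have hbd : Bornology.IsBounded (range fun n => (t n).centre) := by
    obtain ⟨R, hR⟩ := (Metric.isBounded_range_of_tendsto f hlim).exists_norm_le
    refine isBounded_iff_forall_norm_le.2 ⟨R + 1, ?_⟩
    rintro _ ⟨n, rfl⟩
    have h1 := hR _ (mem_range_self n)
    have h2 := (t n).norm_sub_centre_lt (htm n)
    have h3 := norm_sub_norm_le (t n).centre (f n)
    rw [norm_sub_rev] at h3
    dsimp only
    linarith
  obtain ⟨a, -, φ, hφ, ha⟩ := tendsto_subseq_of_bounded hbd fun n => mem_range_self n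
  obtain ⟨N, hN⟩ := Metric.tendsto_atTop.1 ha (1 / 2) (by norm_num)
  have same : ∀ n ≥ N, t (φ n) = t (φ N) := by
    intro n hn
    by_contra hne
    have h1 := hT.one_le_norm (htT _) (htT _) hne
    have h2 := dist_triangle_right (t (φ n)).centre (t (φ N)).centre a
    have h3 := hN n hn
    have h4 := hN N le_rfl
    rw [← dist_eq_norm] at h1
    simp only [Function.comp] at h3 h4
    linarith
  refine ⟨t (φ N), htT _, ?_, 1 / ((φ N : ℝ) + 1), by positivity, htm _⟩
  refine (t (φ N)).isClosed_hex.mem_of_tendsto (hlim.comp hφ.tendsto_atTop) ?_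
  filter_upwards [eventually_ge_atTop N] with n hn
  rw [← same n hn]
  exact htm _

/-- The vertex of the hexagon between the edges `0` and `1`. -/
def vertex : ℂ := ⟨1 / 2, Real.sqrt 3 / 6⟩

theorem height_vertex : height 0 vertex = 1 / 2 ∧ height 1 vertex = 1 / 2 := by
  rw [height_zero, height_one]
  refine ⟨rfl, ?_⟩
  simp only [vertex]
  linear_combination sqrt_three_mul_self / 12

theorem vertex_mem_hexagon : vertex ∈ hexagon := by
  have h2 : height 2 vertex = 0 := by
    rw [height_two]
    simp only [vertex]
    linear_combination sqrt_three_mul_self / 12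
  rw [mem_hexagon_iff_abs, height_vertex.1, height_vertex.2, h2]
  norm_num

/-- In a disc of radius `1 / √3` around `vertex`, three points with mutual distances at least `1`
one of which is `0` form the inscribed equilateral triangle `0, 1, ω`. -/
theorem eq_one_or_eq_one_of_separated {p q : ℂ} (hp : Complex.normSq (vertex - p) ≤ 1 / 3)
    (hq : Complex.normSq (vertex - q) ≤ 1 / 3) (hp0 : 1 ≤ Complex.normSq p)
    (hq0 : 1 ≤ Complex.normSq q) (hpq : 1 ≤ Complex.normSq (p - q)) : p = 1 ∨ q = 1 := by
  have s3 := sqrt_three_mul_self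
  rcases p with ⟨a, b⟩
  rcases q with ⟨c, d⟩
  simp only [Complex.normSq_apply, vertex, Complex.sub_re, Complex.sub_im] at hp hq hp0 hq0 hpq
  -- The sum of the squared mutual distances is at most three times that of the squared distances
  -- from the centre, with equality only if the centre is the barycentre.
  have bary : (a + c - 3 / 2) ^ 2 + (b + d - Real.sqrt 3 / 2) ^ 2 ≤ 0 := by nlinarith
  have n1 := sq_nonneg (a + c - 3 / 2)
  have n2 := sq_nonneg (b + d - Real.sqrt 3 / 2)
  have e1 : a + c - 3 / 2 = 0 := pow_eq_zero_iff two_ne_zero |>.1 (by linarith)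
  have e2 : b + d - Real.sqrt 3 / 2 = 0 := pow_eq_zero_iff two_ne_zero |>.1 (by linarith)
  obtain rfl : c = 3 / 2 - a := by linarith
  obtain rfl : d = Real.sqrt 3 / 2 - b := by linarith
  have f1 : a + b * Real.sqrt 3 / 3 = 1 := by nlinarith
  have f2 : a * a + b * b = 1 := by nlinarith
  have f3 : b * (2 * b - Real.sqrt 3) = 0 := by
    obtain rfl : a = 1 - b * Real.sqrt 3 / 3 := by linarith
    linear_combination 3 / 2 * f2 - b ^ 2 / 6 * s3
  rcases mul_eq_zero.1 f3 with hb | hb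
  · left
    apply Complex.ext
    · rw [hb] at f1; simpa using f1
    · simpa using hb
  · right
    obtain rfl : b = Real.sqrt 3 / 2 := by linarith
    apply Complex.ext
    · simp only [Complex.one_re]; nlinarith
    · simp

/-- A tile has a neighbour across each edge, centred at the mirror image of its centre: the three
tiles around a vertex are needed to cover its neighbourhood, and their centres have mutual
distances at least `1`. -/
theorem IsTiling.exists_neighbour (hT : IsTiling T) {t : Tile} (ht : t ∈ T) (k : ZMod 6) :
    ∃ t' ∈ T, t'.centre = t.centre + t.rot * dir k := by
  set r : ℂ := t.rot * dir k with hr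
  have hr1 : ‖r‖ = 1 := norm_rot_mul_dir _ _
  have hrr := conj_mul_self_of_norm hr1
  set V : ℂ := t.centre + r * vertex with hV
  have fV : t.frame k V = vertex := by
    rw [Tile.frame, ← hr, hV, add_sub_cancel_left, ← mul_assoc, hrr, one_mul]
  have Vt : V ∈ t.hex := by rw [t.mem_hex_iff k, fV]; exact vertex_mem_hexagon
  -- A step from the vertex with positive component along one of the two normals leaves the tile.
  have leave : ∀ w : ℂ, (0 < height 0 w ∨ 0 < height 1 w) → ∀ ε : ℝ, 0 < ε →
      V + ε * (r * w) ∉ t.hex := by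
    intro w hw ε hε hm
    rw [t.mem_hex_iff k, t.frame_add_smul, fV, ← hr, ← mul_assoc (starRingEnd ℂ r), hrr, one_mul,
      mem_hexagon] at hm
    have h0 := hm 0
    have h1 := hm 1
    rw [height_add, height_smul] at h0 h1
    rw [height_vertex.1] at h0
    rw [height_vertex.2] at h1
    rcases hw with hw | hw
    · have := mul_pos hε hw; linarith
    · have := mul_pos hε hw; linarith
  obtain ⟨t1, ht1, Vt1, ε1, hε1, m1⟩ := hT.exists_mem_direction V (r * 1)
  have ne1 : t1 ≠ t := by
    rintro rfl
    exact leave 1 (Or.inl (by rw [height_zero]; norm_num)) ε1 hε1 m1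
  obtain ⟨k1, hk1⟩ := t1.exists_height_eq Vt1 (hT.2 t1 ht1 t ht ne1 ⟨Vt1, Vt⟩).1
  -- The second tile lies in a half-plane with outward normal `r * n` through the vertex.
  obtain ⟨n, hn⟩ : ∃ n : ℂ, (t1.rot : ℂ) * dir k1 = r * n :=
    ⟨(starRingEnd ℂ) r * (t1.rot * dir k1), by rw [← mul_assoc, mul_comm r, hrr, one_mul]⟩
  have hn1 : ‖n‖ = 1 := by
    have := norm_rot_mul_dir t1.rot k1
    rwa [hn, norm_mul, hr1, one_mul] at this
  obtain ⟨w, hwn, hw⟩ : ∃ w : ℂ, 0 < (w * (starRingEnd ℂ) n).re ∧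
      (0 < height 0 w ∨ 0 < height 1 w) := by
    by_cases hm : n = -1
    · refine ⟨dir 2, ?_, Or.inr ?_⟩
      · rw [hm, dir_two]; simp
      · rw [height_dir, show (2 : ZMod 6) - 1 = 1 by decide, dir_one]; norm_num
    · have hsq : n.re ^ 2 + n.im ^ 2 = 1 := by
        have := Complex.sq_norm n
        rw [hn1, Complex.normSq_apply] at this
        linarith
      have hre : 0 < n.re + 1 := by
        have h1 : -1 ≤ n.re := by nlinarith [sq_nonneg n.im]
        rcases h1.eq_or_lt with h | h
        · refine absurd (Complex.ext ?_ ?_) hm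
          · simp [← h]
          · have : n.im ^ 2 = 0 := by rw [← h] at hsq; linarith
            simpa using this
        · linarith
      refine ⟨n + 1, ?_, Or.inl ?_⟩
      · simp only [Complex.mul_re, Complex.add_re, Complex.add_im, Complex.one_re, Complex.one_im,
          Complex.conj_re, Complex.conj_im]
        nlinarith
      · rw [height_zero]; simpa using hre
  obtain ⟨t2, ht2, Vt2, ε2, hε2, m2⟩ := hT.exists_mem_direction V (r * w)
  have ne2 : t2 ≠ t := by
    rintro rfl
    exact leave w hw ε2 hε2 m2
  have ne12 : t1 ≠ t2 := by
    rintro rfl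
    have h1 := mem_hexagon.1 ((t1.mem_hex_iff 0 _).1 m2) k1
    rw [t1.frame_add_smul, height_add, height_smul, hk1] at h1
    have e : height k1 ((starRingEnd ℂ) (t1.rot * dir 0) * (r * w))
        = (w * (starRingEnd ℂ) n).re := by
      have h2 : (starRingEnd ℂ) (t1.rot : ℂ) * dir (-k1) = (starRingEnd ℂ) r * (starRingEnd ℂ) n := by
        rw [← conj_dir, ← map_mul, hn, map_mul]
      rw [height, dir_zero, mul_one]
      congr 1
      linear_combination r * w * h2 + w * (starRingEnd ℂ) n * hrr
    rw [e] at h1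
    have := mul_pos hε2 hwn
    linarith
  -- The three centres in the frame of `t`.
  have coord : ∀ s : Tile, ∃ p, s.centre = t.centre + r * p := fun s =>
    ⟨(starRingEnd ℂ) r * (s.centre - t.centre), by
      rw [← mul_assoc, mul_comm r, hrr]; ring⟩
  have sq_r : ∀ p : ℂ, Complex.normSq (r * p) = Complex.normSq p := by
    intro p
    rw [map_mul, Complex.normSq_eq_norm_sq r, hr1]; ring
  have far : ∀ s s' : Tile, s ∈ T → s' ∈ T → s ≠ s' →
      1 ≤ Complex.normSq (s.centre - s'.centre) := by
    intro s s' hs hs' hne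
    have := hT.one_le_norm hs hs' hne
    rw [Complex.normSq_eq_norm_sq]
    nlinarith
  have near : ∀ s : Tile, V ∈ s.hex → Complex.normSq (V - s.centre) ≤ 1 / 3 := by
    intro s hs
    have := s.normSq_sub_centre_le hs 0
    rwa [Complex.normSq_eq_norm_sq, s.norm_frame, ← Complex.normSq_eq_norm_sq] at this
  obtain ⟨p, hp⟩ := coord t1
  obtain ⟨q, hq⟩ := coord t2
  have np := near t1 Vt1
  have nq := near t2 Vt2
  have fp := far t1 t ht1 ht ne1
  have fq := far t2 t ht2 ht ne2
  have fpq := far t1 t2 ht1 ht2 ne12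
  rw [hp, hV, add_sub_add_left_eq_sub, ← mul_sub, sq_r] at np
  rw [hq, hV, add_sub_add_left_eq_sub, ← mul_sub, sq_r] at nq
  rw [hp, add_sub_cancel_left, sq_r] at fp
  rw [hq, add_sub_cancel_left, sq_r] at fq
  rw [hp, hq, add_sub_add_left_eq_sub, ← mul_sub, sq_r] at fpq
  rcases eq_one_or_eq_one_of_separated np nq fp fq fpq with rfl | rfl
  · exact ⟨t1, ht1, by rw [hp, mul_one]⟩
  · exact ⟨t2, ht2, by rw [hq, mul_one]⟩

/-- Neighbouring tiles have parallel edges: otherwise the centre of one would be too close to a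
centre of a neighbour of the other. -/
theorem IsTiling.exists_rot_eq (hT : IsTiling T) {t t' : Tile} (ht : t ∈ T) (ht' : t' ∈ T)
    {k : ZMod 6} (hc : t'.centre = t.centre + t.rot * dir k) :
    ∃ i, (t'.rot : ℂ) = t.rot * dir i := by
  have h1 := conj_mul_self_circle t'.rot
  obtain ⟨s, hs⟩ : ∃ s : ℂ, t.centre = t'.centre + t'.rot * s :=
    ⟨(starRingEnd ℂ) (t'.rot : ℂ) * (t.centre - t'.centre), by
      linear_combination (-(t.centre - t'.centre)) * h1⟩
  have hrot : (t.rot : ℂ) * dir k = -(t'.rot * s) := by linear_combination -hs - hc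
  have hs1 : ‖s‖ = 1 := by
    have := norm_rot_mul_dir t.rot k
    rwa [hrot, norm_neg, norm_mul, Circle.norm_coe, one_mul] at this
  obtain ⟨j, hj⟩ : ∃ j, s = dir j := by
    by_contra! hne
    have hmem : s ∈ hexagon := by
      rw [mem_hexagon]
      intro j
      obtain ⟨t2, ht2, h2⟩ := hT.exists_neighbour ht' j
      have hne2 : t2 ≠ t := by
        rintro rfl
        rw [h2] at hs
        have : (t'.rot : ℂ) * dir j = t'.rot * s := add_left_cancel hs
        exact hne j (mul_left_cancel₀ (Circle.coe_ne_zero _) this).symm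
      have far := hT.one_le_norm ht2 ht hne2
      rw [h2, hs, add_sub_add_left_eq_sub, ← mul_sub, norm_mul, Circle.norm_coe, one_mul] at far
      have e : ‖dir j - s‖ ^ 2 = 2 - 2 * height j s := by
        rw [Complex.sq_norm, Complex.normSq_sub, Complex.normSq_eq_norm_sq,
          Complex.normSq_eq_norm_sq, norm_dir, hs1, height, ← conj_dir, ← Complex.conj_re]
        simp only [map_mul, Complex.conj_conj]
        rw [mul_comm s]
        ring
      nlinarith
    have := normSq_le_of_mem_hexagon hmem
    rw [Complex.normSq_eq_norm_sq, hs1] at this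
    norm_num at this
  refine ⟨k - j + 3, ?_⟩
  have h2 := dir_mul_dir_neg j
  rw [dir_add_three, sub_eq_add_neg, dir_add]
  rw [hj] at hrot
  linear_combination (-(t'.rot : ℂ)) * h2 + dir (-j) * hrot

/-! ### Tilings over the triangular lattice -/

/-- The element of the circle in direction `k`. -/
def circleDir (k : ZMod 6) : Circle := ⟨dir k, mem_sphere_zero_iff_norm.2 (norm_dir k)⟩

/-- The tile at the lattice point `x` with orientation `k`, in a lattice with origin `c` and
first direction `u`. -/
def latticeTile (c : ℂ) (u : Circle) (x : ℤ × ℤ) (k : ZMod 6) : Tile :=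
  ⟨c + u * point x, u * circleDir k⟩

/-- The set of tiles with orientations `κ` at the points of a triangular lattice. -/
def latticeTiling (c : ℂ) (u : Circle) (κ : ℤ × ℤ → ZMod 6) : Set Tile :=
  range fun x => latticeTile c u x (κ x)

theorem latticeTile_rot (c : ℂ) (u : Circle) (x : ℤ × ℤ) (k : ZMod 6) :
    ((latticeTile c u x k).rot : ℂ) = u * dir k := Circle.coe_mul _ _

/-- Every tiling is a honeycomb. -/
theorem IsTiling.exists_eq_latticeTiling (hT : IsTiling T) :
    ∃ c u κ, T = latticeTiling c u κ := by
  obtain ⟨t0, ht0⟩ : T.Nonempty := by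
    by_contra h
    rw [not_nonempty_iff_eq_empty] at h
    have := hT.1
    rw [h] at this
    simp only [mem_empty_iff_false, iUnion_of_empty, iUnion_empty] at this
    exact empty_ne_univ this
  have all : ∀ x, ∃ k, latticeTile t0.centre t0.rot x k ∈ T := by
    refine lattice_induction ⟨0, ?_⟩ ?_
    · convert ht0
      refine Tile.ext ?_ ?_
      · simp [latticeTile, point]
      · refine Circle.ext ?_
        rw [latticeTile_rot, dir_zero, mul_one]
    · rintro x j ⟨k, hk⟩
      obtain ⟨t', ht', hc⟩ := hT.exists_neighbour hk (j - k)
      obtain ⟨i, hi⟩ := hT.exists_rot_eq hk ht' hc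
      refine ⟨k + i, ?_⟩
      convert ht'
      refine Tile.ext ?_ (Circle.ext ?_)
      · rw [hc, latticeTile_rot, mul_assoc, ← dir_add, add_sub_cancel]
        simp only [latticeTile, point_add, point_step]
        ring
      · rw [hi, latticeTile_rot, latticeTile_rot, mul_assoc, dir_add]
  choose κ hκ using all
  refine ⟨t0.centre, t0.rot, κ, Subset.antisymm ?_ (range_subset_iff.2 hκ)⟩
  intro t ht
  have h1 := conj_mul_self_circle t0.rot
  obtain ⟨x, hx⟩ := exists_sub_point_mem_hexagon
    ((starRingEnd ℂ) (t0.rot : ℂ) * (t.centre - t0.centre))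
  refine ⟨x, ?_⟩
  by_contra hne
  have far := hT.one_le_norm ht (hκ x) (Ne.symm hne)
  have e : t.centre - (latticeTile t0.centre t0.rot x (κ x)).centre
      = t0.rot * ((starRingEnd ℂ) (t0.rot : ℂ) * (t.centre - t0.centre) - point x) := by
    simp only [latticeTile]
    linear_combination (-(t.centre - t0.centre)) * h1
  have := normSq_le_of_mem_hexagon hx
  rw [e, norm_mul, Circle.norm_coe, one_mul] at far
  rw [Complex.normSq_eq_norm_sq] at this
  nlinarith

end Honeycomb

section Lattice

variable {c : ℂ} {u : Circle} {κ : ℤ × ℤ → ZMod 6}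

/-- Points of the plane in the coordinates of the lattice. -/
theorem exists_coordinate (c : ℂ) (u : Circle) (z : ℂ) : ∃ w, z = c + u * w :=
  ⟨(starRingEnd ℂ) (u : ℂ) * (z - c), by
    linear_combination (-(z - c)) * conj_mul_self_circle u⟩

theorem frame_latticeTile (x : ℤ × ℤ) (k j : ZMod 6) (w : ℂ) :
    (latticeTile c u x k).frame j (c + u * w) = dir (-k) * dir (-j) * (w - point x) := by
  have h := conj_mul_self_circle u
  rw [Tile.frame, latticeTile_rot, map_mul, map_mul, conj_dir, conj_dir]
  simp only [latticeTile]
  linear_combination dir (-k) * dir (-j) * (w - point x) * h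

theorem mem_hex_latticeTile {x : ℤ × ℤ} {k : ZMod 6} {w : ℂ} :
    c + u * w ∈ (latticeTile c u x k).hex ↔ w - point x ∈ hexagon := by
  rw [Tile.mem_hex_iff _ 0, frame_latticeTile, mul_assoc, dir_mul_mem_hexagon,
    dir_mul_mem_hexagon]

theorem mem_image_latticeTile {x : ℤ × ℤ} {k : ZMod 6} {w : ℂ} {S : Set ℂ} :
    c + u * w ∈ (latticeTile c u x k).isometry '' S ↔ dir (-k) * (w - point x) ∈ S := by
  have h := dir_mul_dir_neg k
  have e : ∀ v, (latticeTile c u x k).isometry v = c + u * (dir k * v + point x) := by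
    intro v
    rw [Tile.isometry, latticeTile_rot]
    simp only [latticeTile]
    ring
  constructor
  · rintro ⟨v, hv, hvw⟩
    rw [e] at hvw
    have := mul_left_cancel₀ (Circle.coe_ne_zero u) (add_left_cancel hvw)
    rwa [← this, add_sub_cancel_right, ← mul_assoc, mul_comm (dir (-k)), h, one_mul]
  · intro hv
    refine ⟨_, hv, ?_⟩
    rw [e]
    linear_combination u * (w - point x) * h

theorem latticeTile_inj {x y : ℤ × ℤ} {k l : ZMod 6}
    (h : (latticeTile c u x k).centre = (latticeTile c u y l).centre) : x = y :=
  point_injective (mul_left_cancel₀ (Circle.coe_ne_zero u) (add_left_cancel h))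

theorem isTiling_latticeTiling : IsTiling (latticeTiling c u κ) := by
  constructor
  · refine eq_univ_of_forall fun z => ?_
    obtain ⟨w, rfl⟩ := exists_coordinate c u z
    obtain ⟨x, hx⟩ := exists_sub_point_mem_hexagon w
    exact mem_biUnion (mem_range_self x) (mem_hex_latticeTile.2 hx)
  · have half : ∀ x y, x ≠ y → (latticeTile c u x (κ x)).hex ∩ (latticeTile c u y (κ y)).hex ⊆
        frontier (latticeTile c u x (κ x)).hex := by
      rintro x y hxy z ⟨hx, hy⟩
      obtain ⟨w, rfl⟩ := exists_coordinate c u z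
      obtain ⟨j, -, hj⟩ := exists_step_of_mem_hexagon hxy (mem_hex_latticeTile.1 hx)
        (mem_hex_latticeTile.1 hy)
      refine Tile.mem_frontier (k := j - κ x) _ hx ?_
      rw [frame_latticeTile, neg_zero, dir_zero, mul_one, height_dir_mul]
      simpa using hj
    rintro _ ⟨x, rfl⟩ _ ⟨y, rfl⟩ hne
    have hxy : x ≠ y := by rintro rfl; exact hne rfl
    exact subset_inter (half x y hxy) (by rw [inter_comm]; exact half y x hxy.symm)

/-- Continuity of the black curves across the edges of a honeycomb. -/
def Glues (κ : ℤ × ℤ → ZMod 6) : Prop :=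
  ∀ x j, onRight (j + 3 - κ (x + step j)) = true ↔ ¬ onRight (j - κ x) = true

theorem edgePoint_mem_hexagon (j : ZMod 6) (r : Bool) : edgePoint j r ∈ hexagon := by
  obtain ⟨l, hl⟩ : ∃ l, onRight l = r := by decide +revert
  have h : height j (edgePoint j r) = 1 / 2 := height_edgePoint j r
  have := (rotate_mem_protoBlack_iff (k := j - l) h).2 (by rw [sub_sub_cancel, hl])
  rw [← dir_mul_mem_hexagon]
  exact protoBlack_subset_hexagon this

theorem Tile.black_subset_hex (t : Tile) : t.black ⊆ t.hex :=
  image_mono protoBlack_subset_hexagon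

theorem satisfiesR1_iff : SatisfiesR1 (latticeTiling c u κ) ↔ Glues κ := by
  have move : ∀ (x : ℤ × ℤ) (j : ZMod 6) (r : Bool),
      point x + edgePoint j r - point (x + step j) = edgePoint (j + 3) (!r) := by
    intro x j r
    rw [← edgePoint_sub_dir, point_add, point_step]
    ring
  constructor
  · intro h x j
    have hne : x ≠ x + step j := by
      intro e
      have : step j = 0 := by simpa using e.symm
      have key : ∀ j, step j ≠ 0 := by decide
      exact key j this
    have h1 := h _ (mem_range_self x) _ (mem_range_self (x + step j))
      (fun e => hne (latticeTile_inj (congrArg Tile.centre e)))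
    set r := onRight (j - κ x) with hr
    have m1 : c + u * (point x + edgePoint j r) ∈ (latticeTile c u x (κ x)).black := by
      refine mem_image_latticeTile.2 ?_
      rw [add_sub_cancel_left, rotate_mem_protoBlack_iff (height_edgePoint _ _)]
    have m2 : c + u * (point x + edgePoint j r)
        ∈ (latticeTile c u (x + step j) (κ (x + step j))).hex := by
      rw [mem_hex_latticeTile, move]
      exact edgePoint_mem_hexagon _ _
    have m3 := ((Set.ext_iff.1 h1 _).1 ⟨m1, m2⟩).1
    have m4 := mem_image_latticeTile.1 m3
    rw [move, rotate_mem_protoBlack_iff (height_edgePoint _ _)] at m4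
    rw [← edgePoint_injective _ m4]
    simp
  · intro h
    have half : ∀ x y, x ≠ y → (latticeTile c u x (κ x)).black ∩ (latticeTile c u y (κ y)).hex ⊆
        (latticeTile c u y (κ y)).black ∩ (latticeTile c u x (κ x)).hex := by
      rintro x y hxy z ⟨hx, hy⟩
      have hx' := Tile.black_subset_hex _ hx
      refine ⟨?_, hx'⟩
      obtain ⟨w, rfl⟩ := exists_coordinate c u z
      obtain ⟨j, rfl, hj⟩ := exists_step_of_mem_hexagon hxy (mem_hex_latticeTile.1 hx')
        (mem_hex_latticeTile.1 hy)
      have h1 := (rotate_mem_protoBlack_iff hj).1 (mem_image_latticeTile.1 hx)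
      refine mem_image_latticeTile.2 ?_
      have h2 : w - point (x + step j) = edgePoint (j + 3) (!onRight (j - κ x)) := by
        rw [← move x, ← h1, add_sub_cancel]
      have h3 : (!onRight (j - κ x)) = onRight (j + 3 - κ (x + step j)) := by
        have := h x j
        cases h4 : onRight (j - κ x) <;> cases h5 : onRight (j + 3 - κ (x + step j)) <;>
          simp [h4, h5] at this ⊢
      rw [h2, rotate_mem_protoBlack_iff (height_edgePoint _ _), h3]
    rintro _ ⟨x, rfl⟩ _ ⟨y, rfl⟩ hne
    have hxy : x ≠ y := by rintro rfl; exact hne rfl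
    exact Subset.antisymm (half x y hxy) (half y x hxy.symm)

/-! ### R1-triangles in the plane and on the lattice -/

theorem dir_injective : Function.Injective dir := by
  intro i j h
  by_contra hne
  have h1 := re_dir_le (sub_ne_zero.2 hne)
  rw [sub_eq_add_neg, dir_add, h, ← dir_add, add_neg_cancel, dir_zero] at h1
  norm_num at h1

theorem mul_dir_eq_iff {x : ℤ × ℤ} {k m n : ZMod 6} :
    (u : ℂ) * dir m = (latticeTile c u x k).rot * dir n ↔ m = k + n := by
  rw [latticeTile_rot, mul_assoc, ← dir_add]
  exact ⟨fun h => dir_injective (mul_left_cancel₀ (Circle.coe_ne_zero u) h), fun h => by rw [h]⟩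

theorem hasLine_iff {x : ℤ × ℤ} {k m : ZMod 6} :
    (latticeTile c u x k).HasLine (u * dir m) ↔ tileAxis k = axis m := by
  change (_ = _ * dir 1 ∨ _ = _ * dir 4) ↔ _
  rw [mul_dir_eq_iff, mul_dir_eq_iff]
  decide +revert

theorem hasCorner_iff {x : ℤ × ℤ} {k m : ZMod 6} :
    (latticeTile c u x k).HasCorner (u * dir m) ↔ tileAxis k = axis m + 1 := by
  change (_ = _ * dir 2 ∨ _ = _ * dir 5) ↔ _
  rw [mul_dir_eq_iff, mul_dir_eq_iff]
  decide +revert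

theorem exists_tile_iff {x : ℤ × ℤ} {p : Tile → Prop} :
    (∃ t ∈ latticeTiling c u κ, t.centre = c + u * point x ∧ p t) ↔
      p (latticeTile c u x (κ x)) := by
  constructor
  · rintro ⟨_, ⟨y, rfl⟩, h1, h2⟩
    obtain rfl := latticeTile_inj (k := κ y) (l := κ x) h1
    exact h2
  · exact fun h => ⟨_, mem_range_self x, rfl, h⟩

theorem cornerAt_iff {x : ℤ × ℤ} {m : ZMod 6} :
    CornerAt (latticeTiling c u κ) (c + u * point x) (u * dir m) ↔
      tileAxis (κ x) = axis m + 1 := by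
  rw [CornerAt, exists_tile_iff, hasCorner_iff]

theorem point_add_smul_step (x : ℤ × ℤ) (i : ℤ) (m : ZMod 6) :
    c + u * point x + i * (u * dir m) = c + u * point (x + i • step m) := by
  rw [point_add, point_smul, point_step]
  ring

theorem lineFrom_iff {x : ℤ × ℤ} {m : ZMod 6} {n : ℕ} :
    LineFrom (latticeTiling c u κ) (c + u * point x) (u * dir m) n ↔
      ∀ i : ℤ, 0 < i → i < n + 1 → tileAxis (κ (x + i • step m)) = axis m := by
  have key : ∀ j : ℕ, (∃ t ∈ latticeTiling c u κ,
      t.centre = c + u * point x + j * (u * dir m) ∧ t.HasLine (u * dir m)) ↔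
        tileAxis (κ (x + (j : ℤ) • step m)) = axis m := by
    intro j
    rw [← Int.cast_natCast (R := ℂ), point_add_smul_step, exists_tile_iff, hasLine_iff]
  unfold LineFrom
  simp only [key]
  constructor
  · intro h i h0 h1
    lift i to ℕ using h0.le
    exact h i (by omega) (by omega)
  · intro h j h0 h1
    exact h j (by omega) (by omega)

theorem isR1Triangle_iff {x : ℤ × ℤ} {m : ZMod 6} {n : ℕ} :
    IsR1Triangle (latticeTiling c u κ) (c + u * point x) (u * dir m) n ↔
      IsTriangle (fun y => tileAxis (κ y)) x m (n + 1) := by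
  have d1 : ω * (u * dir m) = u * dir (m + 1) := by
    rw [dir_add, show dir 1 = ω from pow_one ω]; ring
  have d2 : ω ^ 2 * (u * dir m) = u * dir (m + 2) := by
    rw [dir_add, show dir 2 = ω ^ 2 from rfl]; ring
  have d4 : ω ^ 4 * (u * dir m) = u * dir (m + 4) := by
    rw [dir_add, show dir 4 = ω ^ 4 from rfl]; ring
  have e : ((n : ℂ) + 1) = ((n + 1 : ℤ) : ℂ) := by push_cast; rfl
  rw [IsR1Triangle, d1, d2, d4, e, point_add_smul_step, point_add_smul_step]
  simp only [cornerAt_iff, lineFrom_iff]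
  rfl

theorem IsTriangle.unique {h : ℤ × ℤ → ZMod 3} {p : ℤ × ℤ} {j : ZMod 6} {N N' : ℤ} (hN : 0 < N)
    (hN' : 0 < N') (t : IsTriangle h p j N) (t' : IsTriangle h p j N') : N = N' := by
  have main : ∀ N N', 0 < N → IsTriangle h p j N → IsTriangle h p j N' → ¬ N < N' := by
    intro N N' hN t t' hlt
    have h1 := t.2.1.1
    rw [t'.1.2 N hN hlt, axis_add_two] at h1
    generalize axis j = a at h1
    exact absurd h1 (by decide +revert)
  have := main N N' hN t t'
  have := main N' N hN' t' t
  omega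

theorem r1Length_eq {x : ℤ × ℤ} {m : ZMod 6} {n : ℕ}
    (h : IsTriangle (fun y => tileAxis (κ y)) x m (n + 1)) :
    r1Length (latticeTiling c u κ) (c + u * point x) (u * dir m) = n := by
  refine le_antisymm (iInf₂_le n (isR1Triangle_iff.2 h)) (le_iInf₂ fun n' h' => ?_)
  have := (isR1Triangle_iff.1 h').unique (by omega) (by omega) h
  rw [show n' = n by omega]

theorem r1Length_eq_top {x : ℤ × ℤ} {m : ZMod 6}
    (h : ∀ n : ℕ, ¬ IsTriangle (fun y => tileAxis (κ y)) x m (n + 1)) :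
    r1Length (latticeTiling c u κ) (c + u * point x) (u * dir m) = ⊤ := by
  unfold r1Length
  simp [isR1Triangle_iff, h]

/-- The condition on lengths that singles out the class `𝒞₀`. -/
theorem lengths_eq_iff :
    (∀ t ∈ latticeTiling c u κ, ∀ d d' : ℂ, t.HasCorner d → t.HasCorner d' →
      r1Length (latticeTiling c u κ) t.centre d = r1Length (latticeTiling c u κ) t.centre d') ↔
    IsBalanced fun y => tileAxis (κ y) := by
  constructor
  · intro H p j N hN ht
    obtain ⟨n, rfl⟩ : ∃ n : ℕ, N = n + 1 := ⟨(N - 1).toNat, by omega⟩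
    have h1 := H _ (mem_range_self p) (u * dir j) (u * dir (j + 3)) (hasCorner_iff.2 ht.1.1)
      (hasCorner_iff.2 (by rw [axis_add_three]; exact ht.1.1))
    have h2 : r1Length (latticeTiling c u κ) (c + u * point p) (u * dir j) = n := r1Length_eq ht
    have h3 : r1Length (latticeTiling c u κ) (c + u * point p) (u * dir (j + 3)) = n :=
      h1.symm.trans h2
    by_contra hno
    by_cases hex : ∃ n' : ℕ, IsTriangle (fun y => tileAxis (κ y)) p (j + 3) (n' + 1)
    · obtain ⟨n', hn'⟩ := hex
      rw [r1Length_eq hn', Nat.cast_inj] at h3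
      exact hno (h3 ▸ hn')
    · push Not at hex
      rw [r1Length_eq_top hex] at h3
      exact ENat.top_ne_natCast n h3
  · rintro B _ ⟨x, rfl⟩ d d' hd hd'
    have opp : ∀ j : ZMod 6, r1Length (latticeTiling c u κ) (c + u * point x) (u * dir j)
        = r1Length (latticeTiling c u κ) (c + u * point x) (u * dir (j + 3)) := by
      intro j
      have back : ∀ n : ℕ, IsTriangle (fun y => tileAxis (κ y)) x (j + 3) (n + 1) →
          IsTriangle (fun y => tileAxis (κ y)) x j (n + 1) := by
        intro n h
        have := B _ _ _ (by omega) h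
        rwa [add_assoc, show (3 : ZMod 6) + 3 = 0 by decide, add_zero] at this
      by_cases hex : ∃ n : ℕ, IsTriangle (fun y => tileAxis (κ y)) x j (n + 1)
      · obtain ⟨n, hn⟩ := hex
        rw [r1Length_eq hn, r1Length_eq (B _ _ _ (by omega) hn)]
      · push Not at hex
        rw [r1Length_eq_top hex, r1Length_eq_top fun n h => hex n (back n h)]
    have cases : ∀ d, (latticeTile c u x (κ x)).HasCorner d →
        r1Length (latticeTiling c u κ) (c + u * point x) d
          = r1Length (latticeTiling c u κ) (c + u * point x) (u * dir (κ x + 2)) := by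
      intro d hd
      change (_ = _ * dir 2 ∨ _ = _ * dir 5) at hd
      rw [latticeTile_rot, mul_assoc, mul_assoc, ← dir_add, ← dir_add] at hd
      rcases hd with rfl | rfl
      · rfl
      · rw [opp (κ x + 2), add_assoc, show (2 : ZMod 6) + 3 = 5 by decide]
    exact (cases d hd).trans (cases d' hd').symm

end Lattice

/-! ### Nonperiodicity and existence -/

theorem nonperiodic_of_mem_classC0 {T : Set Tile} (hT : T ∈ classC0) : Nonperiodic T := by
  obtain ⟨⟨tiling, r1, -⟩, lengths⟩ := hT
  obtain ⟨c, u, κ, rfl⟩ := tiling.exists_eq_latticeTiling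
  have H := isMatched_of_glue (satisfiesR1_iff.1 r1)
  have B := lengths_eq_iff.1 lengths
  intro v hv
  have move : ∀ x, ∃ y, latticeTile c u y (κ y) = (latticeTile c u x (κ x)).translate v := by
    intro x
    have : (latticeTile c u x (κ x)).translate v ∈ latticeTiling c u κ :=
      hv ▸ mem_image_of_mem _ (mem_range_self x)
    exact this
  obtain ⟨y, hy⟩ := move 0
  have hv1 : v = u * point y := by
    have := congrArg Tile.centre hy
    simp only [latticeTile, Tile.translate, point, Prod.fst_zero, Prod.snd_zero] at this ⊢
    push_cast at this
    linear_combination -this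
  have per : ∀ x, κ (x + y) = κ x := by
    intro x
    obtain ⟨z, hz⟩ := move x
    have h1 : z = x + y := by
      refine latticeTile_inj (c := c) (u := u) (k := κ z) (l := κ x) ?_
      rw [hz]
      simp only [latticeTile, Tile.translate, point_add, hv1]
      ring
    subst h1
    have h2 := congrArg (fun t : Tile => (t.rot : ℂ)) hz
    have h3 : (u : ℂ) * dir (κ (x + y)) = u * dir (κ x) := by
      rw [← latticeTile_rot c u (x + y), ← latticeTile_rot c u x]; exact h2
    exact dir_injective (mul_left_cancel₀ (Circle.coe_ne_zero u) h3)
  have hy0 : y = 0 := eq_zero_of_period H B fun z => by rw [per]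
  rw [hv1, hy0]
  simp [point]

/-- The tree of the prototile reaches the midpoints of its edges `0`, `1`, `3` and `4`. -/
theorem dir_div_two_mem_protoTree {l : ZMod 6} (hl : l = 0 ∨ l = 1 ∨ l = 3 ∨ l = 4) :
    dir l / 2 ∈ protoTree := by
  rcases hl with rfl | rfl | rfl | rfl
  · exact Or.inl (Or.inl (Or.inl (right_mem_segment ℝ _ _)))
  · exact Or.inl (Or.inl (Or.inr (right_mem_segment ℝ _ _)))
  · exact Or.inl (Or.inr (right_mem_segment ℝ _ _))
  · exact Or.inr (right_mem_segment ℝ _ _)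

theorem isConnected_protoTree : IsConnected protoTree := by
  have seg : ∀ w : ℂ, IsPreconnected (segment ℝ 0 w) := fun w =>
    (convex_segment 0 w).isPreconnected
  have z : ∀ w : ℂ, (0 : ℂ) ∈ segment ℝ 0 w := fun w => left_mem_segment ℝ 0 w
  refine ⟨⟨0, Or.inr (z _)⟩, ?_⟩
  refine IsPreconnected.union 0 (Or.inr (z _)) (z _) ?_ (seg _)
  refine IsPreconnected.union 0 (Or.inr (z _)) (z _) ?_ (seg _)
  exact IsPreconnected.union 0 (z _) (z _) (seg _) (seg _)

theorem Tile.isConnected_tree (t : Tile) : IsConnected t.tree := by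
  refine isConnected_protoTree.image _ (Continuous.continuousOn ?_)
  unfold Tile.isometry
  fun_prop

/-- The trees of adjacent tiles meet in the midpoint of the common edge if neither of them
avoids it. -/
theorem tree_inter_nonempty {x y : ℤ × ℤ} (h : RedAdj x y) :
    ((latticeTile 0 1 x (orient x)).tree ∩ (latticeTile 0 1 y (orient y)).tree).Nonempty := by
  obtain ⟨j, rfl, h1, h2⟩ := h
  rw [← tileAxis_orient] at h1 h2
  have key : ∀ j k : ZMod 6, tileAxis k ≠ axis j + 1 →
      (j - k = 0 ∨ j - k = 1 ∨ j - k = 3 ∨ j - k = 4) ∧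
        (j + 3 - k = 0 ∨ j + 3 - k = 1 ∨ j + 3 - k = 3 ∨ j + 3 - k = 4) := by decide
  refine ⟨0 + ((1 : Circle) : ℂ) * (point x + dir j / 2), ?_, ?_⟩
  · refine mem_image_latticeTile.2 ?_
    rw [add_sub_cancel_left, ← mul_div_assoc, ← dir_add, neg_add_eq_sub]
    exact dir_div_two_mem_protoTree (key j _ h1).1
  · refine mem_image_latticeTile.2 ?_
    rw [point_add, point_step, show point x + dir j / 2 - (point x + dir j) = dir (j + 3) / 2 by
      rw [dir_add_three]; ring, ← mul_div_assoc, ← dir_add, neg_add_eq_sub]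
    exact dir_div_two_mem_protoTree (key j _ h2).2

theorem latticeTiling_orient_mem_classC0 : latticeTiling 0 1 orient ∈ classC0 := by
  refine ⟨⟨isTiling_latticeTiling, satisfiesR1_iff.2 glue_orient, ?_⟩, lengths_eq_iff.2 ?_⟩
  · unfold SatisfiesR2 latticeTiling
    rw [biUnion_range]
    refine IsConnected.iUnion_of_reflTransGen (fun x => Tile.isConnected_tree _) fun x y => ?_
    exact Relation.ReflTransGen.mono (fun _ _ => tree_inter_nonempty) _ _ (redConnected x y)
  · simp only [tileAxis_orient]
    exact isBalanced_field

end

end Monotile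

theorem mainTheorem2 :
    Monotile.classC0.Nonempty ∧ ∀ T ∈ Monotile.classC0, Monotile.Nonperiodic T :=
  ⟨⟨_, Monotile.latticeTiling_orient_mem_classC0⟩,
    fun _ hT => Monotile.nonperiodic_of_mem_classC0 hT⟩
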